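/- Let $\mathcal H$ be a finite-dimensional complex Hilbert space, let $\mathrm{Her}(\mathcal H)$ be the real vector space of Hermitian operators on $\mathcal H$, and let $\hbar>0$. Let $\rho_0$ be a density operator (a positive semidefinite Hermitian operator of trace $1$) with spectrum $\sigma$ (eigenvalues counted with multiplicity), and let $\mathcal D(\sigma)=\{U\rho_0U^\dagger : U \text{ a unitary operator on } \mathcal H\}$. Then: 1. $\mathcal D(\sigma)$ is the set of all density operators with spectrum $\sigma$. It is a smooth embedded submanifold of $\mathrm{Her}(\mathcal H)$, and its tangent space at $\rho$ is $T_\rho\mathcal D(\sigma)=\{\tfrac{1}{i\hbar}[A,\rho] : A\in \mathrm{Her}(\mathcal H)\}$. 2. There is exactly one family $\omega=(\omega_\rho)_{\rho\in\mathcal D(\sigma)}$ of alternating real bilinear forms $\omega_\rho$ on $T_\rho\mathcal D(\sigma)$ such that $$\omega_\rho\Bigl(\tfrac{1}{i\hbar}[A,\rho],\tfrac{1}{i\hbar}[B,\rho]\Bigr)=\tfrac{1}{i\hbar}\operatorname{Tr}\bigl([A,B]\rho\bigr)\qquad\text{for all } \rho\in\mathcal D(\sigma),\ A,B\in\mathrm{Her}(\mathcal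 H)$$ (the Kirillov–Kostant–Souriau form). 3. $\omega$ is a symplectic form on $\mathcal D(\sigma)$: it is a smooth $2$-form; it is non-degenerate, i.e. if $X\in T_\rho\mathcal D(\sigma)$ satisfies $\omega_\rho(X,Y)=0$ for all $Y\in T_\rho\mathcal D(\sigma)$, then $X=0$; and it is closed, $d\omega=0$. -/

import Mathlib

open scoped Manifold ContDiff

noncomputable section

section ManifoldForms

variable {F : Type*} [NormedAddCommGroup F] [NormedSpace ℝ F]
  {M : Type*} [TopologicalSpace M] [ChartedSpace F M] {k : ℕ}

/-- The expression of a `k`-form `Ω` on `M` in the preferred chart `φ` around `x₀`: the pullback of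
`Ω` along `φ⁻¹` (meaningful on the open set `φ.target`). -/
def formInChart (Ω : (x : M) → TangentSpace 𝓘(ℝ, F) x [⋀^Fin k]→L[ℝ] ℝ) (x₀ : M) :
    F → F [⋀^Fin k]→L[ℝ] ℝ := fun y ↦
  (Ω ((extChartAt 𝓘(ℝ, F) x₀).symm y)).compContinuousLinearMap
    (mfderiv 𝓘(ℝ, F) 𝓘(ℝ, F) (extChartAt 𝓘(ℝ, F) x₀).symm y)

/-- A `k`-form on a manifold is smooth if its expression in every preferred chart is smooth. -/
def IsSmoothForm (Ω : (x : M) → TangentSpace 𝓘(ℝ, F) x [⋀^Fin k]→L[ℝ] ℝ) : Prop :=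
  ∀ x₀ : M, ContDiffOn ℝ ∞ (formInChart Ω x₀) (extChartAt 𝓘(ℝ, F) x₀).target

/-- The exterior derivative of a `k`-form on a manifold. At `x` it is computed in the preferred
chart around `x` and pulled back to the tangent space at `x` (for a smooth form any other chart of
the smooth structure gives the same value). -/
def extDerivManifold (Ω : (x : M) → TangentSpace 𝓘(ℝ, F) x [⋀^Fin k]→L[ℝ] ℝ) (x : M) :
    TangentSpace 𝓘(ℝ, F) x [⋀^Fin (k + 1)]→L[ℝ] ℝ :=
  (extDeriv (formInChart Ω x) (extChartAt 𝓘(ℝ, F) x x)).compContinuousLinearMap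
    (mfderiv 𝓘(ℝ, F) 𝓘(ℝ, F) (extChartAt 𝓘(ℝ, F) x) x)

/-- A symplectic form: a smooth 2-form that is non-degenerate and closed. -/
structure IsSymplecticForm (Ω : (x : M) → TangentSpace 𝓘(ℝ, F) x [⋀^Fin 2]→L[ℝ] ℝ) : Prop where
  smooth : IsSmoothForm Ω
  nondegenerate : ∀ (x : M) (X : TangentSpace 𝓘(ℝ, F) x),
    (∀ Y : TangentSpace 𝓘(ℝ, F) x, Ω x ![X, Y] = 0) → X = 0
  closed : ∀ x : M, extDerivManifold Ω x = 0

end ManifoldForms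

section QuantumStates

variable {H : Type*} [NormedAddCommGroup H] [InnerProductSpace ℂ H] [CompleteSpace H]

/-- The real normed space of Hermitian operators on `H`. -/
abbrev HermitianOp (H : Type*) [NormedAddCommGroup H] [InnerProductSpace ℂ H] [CompleteSpace H] :=
  selfAdjoint.submodule ℝ (H →L[ℂ] H)

/-- The trace of an operator on `H`. -/
def opTrace (T : H →L[ℂ] H) : ℂ := LinearMap.trace ℂ H (T : H →ₗ[ℂ] H)

/-- The commutator `[A, B] = A B - B A`. -/
def opCommutator (A B : H →L[ℂ] H) : H →L[ℂ] H := A * B - B * A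

/-- Density operators: positive semidefinite Hermitian operators of trace one. -/
def IsDensityOperator (ρ : HermitianOp H) : Prop :=
  (ρ : H →L[ℂ] H).IsPositive ∧ opTrace (ρ : H →L[ℂ] H) = 1

/-- The orbit of `ρ₀` under the action `(U, A) ↦ U A U†` of the unitary group. -/
def unitaryOrbit (ρ₀ : HermitianOp H) : Set (HermitianOp H) :=
  {ρ | ∃ U ∈ unitary (H →L[ℂ] H), (ρ : H →L[ℂ] H) = U * (ρ₀ : H →L[ℂ] H) * star U}

/-- The operator `(1 / iħ) [A, ρ]`, which is Hermitian. -/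
def tangentOp (hbar : ℝ) (A ρ : HermitianOp H) : HermitianOp H :=
  ⟨(1 / (Complex.I * hbar)) • opCommutator (A : H →L[ℂ] H) (ρ : H →L[ℂ] H), by
    have hA : star (A : H →L[ℂ] H) = A := A.2
    have hρ : star (ρ : H →L[ℂ] H) = ρ := ρ.2
    have hc : star (1 / (Complex.I * (hbar : ℂ))) = -(1 / (Complex.I * (hbar : ℂ))) := by
      simp
    change star _ = _
    rw [star_smul, hc, opCommutator, star_sub, star_mul, star_mul, hA, hρ, neg_smul,
      ← smul_neg, neg_sub]⟩

variable (F : Type*) [NormedAddCommGroup F] [NormedSpace ℝ F]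

/-- The differential at `ρ` of the inclusion of the orbit into the space of Hermitian operators;
it identifies abstract tangent vectors of the orbit with Hermitian operators. -/
def tangentInclusion {ρ₀ : HermitianOp H} [ChartedSpace F (unitaryOrbit ρ₀)]
    (ρ : unitaryOrbit ρ₀) : TangentSpace 𝓘(ℝ, F) ρ →L[ℝ] HermitianOp H :=
  mfderiv 𝓘(ℝ, F) 𝓘(ℝ, HermitianOp H) (Subtype.val : unitaryOrbit ρ₀ → HermitianOp H) ρ

variable {F}

/-- The defining property of the Kirillov-Kostant-Souriau form on the orbit:
`Ω_ρ((1 / iħ) [A, ρ], (1 / iħ) [B, ρ]) = (1 / iħ) Tr([A, B] ρ)` for all Hermitian `A`, `B`. -/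
def IsKKSForm (hbar : ℝ) {ρ₀ : HermitianOp H} [ChartedSpace F (unitaryOrbit ρ₀)]
    (Ω : (ρ : unitaryOrbit ρ₀) → TangentSpace 𝓘(ℝ, F) ρ [⋀^Fin 2]→L[ℝ] ℝ) : Prop :=
  ∀ (ρ : unitaryOrbit ρ₀) (A B : HermitianOp H) (X Y : TangentSpace 𝓘(ℝ, F) ρ),
    tangentInclusion F ρ X = tangentOp hbar A ρ → tangentInclusion F ρ Y = tangentOp hbar B ρ →
    ((Ω ρ ![X, Y] : ℝ) : ℂ) = 1 / (Complex.I * hbar) *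
      opTrace (opCommutator (A : H →L[ℂ] H) (B : H →L[ℂ] H) * ((ρ : HermitianOp H) : H →L[ℂ] H))

/-- The charts on the orbit make it a smooth manifold which is smoothly embedded, by the inclusion,
in the space of Hermitian operators. -/
def IsEmbeddedOrbit (ρ₀ : HermitianOp H) (cs : ChartedSpace F (unitaryOrbit ρ₀)) : Prop :=
  IsManifold 𝓘(ℝ, F) ∞ (unitaryOrbit ρ₀) ∧
    Manifold.IsSmoothEmbedding 𝓘(ℝ, F) 𝓘(ℝ, HermitianOp H) ∞
      (Subtype.val : unitaryOrbit ρ₀ → HermitianOp H)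

end QuantumStates

end

/-! Write T for the map A ↦ (1/iħ)[A, ρ]. By cyclicity T is skew for the pairing Tr(AB), which is
positive definite on Hermitian operators, so ker T ∩ range T = 0.

Manifold structure: the map (X, Y) ↦ exp(X/iħ)(ρ + Y)exp(X/iħ)† has differential (X, Y) ↦ TX + Y at
0, hence is a local diffeomorphism on range T × ker T. Conjugation preserves the orbit, and a small
Y commuting with ρ keeps ρ + Y in the orbit only if Y = 0
(`eventually_eq_zero_of_add_mem_unitaryOrbit`). These are slice charts, and they yield smooth local
sections W of U ↦ Uρ₀U†.

Tangent space: in coordinates c = wρ₀w† with w unitary, so Dc = [a, c] with a = (Dw)w† skew-adjoint.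
Conversely, curves exp(tA/iħ)ρ exp(tA/iħ)† lift through the embedding (`range_tangentInclusion`).

The form: (1/iħ)Tr([A, B]ρ) = Tr(A·TB) is skew and therefore depends only on TA and TB. Taking B =
TA gives −Tr((TA)²), whence non-degeneracy. By the Maurer–Cartan equation the form is locally the
exterior derivative of Re(−iħ Tr(ρ₀ w†dw)) (`IsKKSForm.exists_formInChart_eq_extDeriv`), so it is
smooth and closed. -/

open Set Topology Filter

/-! ### Submanifolds from slice charts -/

section SliceCharts

variable {E K N : Type*} [NormedAddCommGroup E] [NormedAddCommGroup K] [NormedAddCommGroup N]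
  {S : Set E}

/-- The chart of a subset `S` of `E` induced by a slice chart of `E`, in which `S` is the set of
points with vanishing second component. -/
noncomputable def sliceChart (e : OpenPartialHomeomorph E (K × N))
    (he : ∀ y ∈ e.source, y ∈ S ↔ (e y).2 = 0) (p : S) : OpenPartialHomeomorph S K where
  toFun y := (e y).1
  -- The point `p` is only a default value off the target.
  invFun u := open Classical in if h : (u, (0 : N)) ∈ e.target then
    ⟨e.symm (u, 0), (he _ (e.map_target h)).2 (by rw [e.right_inv h])⟩ else p
  source := Subtype.val ⁻¹' e.source
  target := {u | (u, (0 : N)) ∈ e.target}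
  map_source' y hy := by
    have h0 : (e y).2 = 0 := (he y hy).1 y.2
    have : ((e y).1, (0 : N)) = e y := Prod.ext rfl h0.symm
    change ((e y).1, (0 : N)) ∈ e.target
    rw [this]
    exact e.map_source hy
  map_target' u hu := by
    change (u, (0 : N)) ∈ e.target at hu
    simp only [dif_pos hu, mem_preimage]
    exact e.map_target hu
  left_inv' y hy := by
    have h0 : (e y).2 = 0 := (he y hy).1 y.2
    have h1 : ((e y).1, (0 : N)) = e y := Prod.ext rfl h0.symm
    have h2 : ((e y).1, (0 : N)) ∈ e.target := h1 ▸ e.map_source hy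
    rw [dif_pos h2]
    exact Subtype.ext (by simp only [h1]; exact e.left_inv hy)
  right_inv' u hu := by
    change (u, (0 : N)) ∈ e.target at hu
    simp only [dif_pos hu]
    rw [e.right_inv hu]
  open_source := e.open_source.preimage continuous_subtype_val
  open_target := e.open_target.preimage (by fun_prop)
  continuousOn_toFun := continuous_fst.comp_continuousOn
    (e.continuousOn.comp continuous_subtype_val.continuousOn fun _ h ↦ h)
  continuousOn_invFun := by
    rw [IsInducing.subtypeVal.continuousOn_iff]
    refine (e.continuousOn_symm.comp (f := fun u : K ↦ (u, (0 : N)))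
      (by fun_prop) fun _ h ↦ h).congr fun u hu ↦ ?_
    simp only [Function.comp_apply]
    change (u, (0 : N)) ∈ e.target at hu
    rw [dif_pos hu]

theorem coe_sliceChart_symm (e : OpenPartialHomeomorph E (K × N))
    (he : ∀ y ∈ e.source, y ∈ S ↔ (e y).2 = 0) (p : S) {u : K} (hu : (u, (0 : N)) ∈ e.target) :
    (((sliceChart e he p).symm u : S) : E) = e.symm (u, 0) :=
  congrArg Subtype.val (dif_pos hu)

variable [NormedSpace ℝ E] [NormedSpace ℝ K] [NormedSpace ℝ N]

/-- A subset of a normed space with smooth slice charts around each of its points is a smoothly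
embedded submanifold. -/
theorem exists_smoothEmbedding_of_sliceCharts (L : (K × N) ≃L[ℝ] E)
    (e : S → OpenPartialHomeomorph E (K × N)) (hmem : ∀ p : S, (p : E) ∈ (e p).source)
    (he : ∀ p, ∀ y ∈ (e p).source, y ∈ S ↔ (e p y).2 = 0)
    (hs : ∀ p, ContDiffOn ℝ ∞ (e p) (e p).source)
    (hs' : ∀ p, ContDiffOn ℝ ∞ (e p).symm (e p).target) :
    ∃ _ : ChartedSpace K S, IsManifold 𝓘(ℝ, K) ∞ S ∧
      Manifold.IsSmoothEmbedding 𝓘(ℝ, K) 𝓘(ℝ, E) ∞ (Subtype.val : S → E) := by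
  let cs : ChartedSpace K S :=
    { atlas := range fun p ↦ sliceChart (e p) (he p) p
      chartAt := fun p ↦ sliceChart (e p) (he p) p
      mem_chart_source := hmem
      chart_mem_atlas := fun p ↦ mem_range_self p }
  have hM : IsManifold 𝓘(ℝ, K) ∞ S := by
    apply isManifold_of_contDiffOn
    rintro _ _ ⟨p, rfl⟩ ⟨q, rfl⟩
    have h1 : ContDiffOn ℝ ∞ (fun u : K ↦ (e q ((e p).symm (u, 0))).1)
        {u | (u, (0 : N)) ∈ (e p).target ∧ (e p).symm (u, 0) ∈ (e q).source} := by
      refine contDiff_fst.comp_contDiffOn ((hs q).comp ((hs' p).comp (t := (e p).target)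
        (f := fun u : K ↦ (u, (0 : N))) ?_ fun u hu ↦ hu.1) fun u hu ↦ hu.2)
      exact (contDiff_id.prodMk contDiff_const).contDiffOn
    have key : ∀ u ∈ ((sliceChart (e p) (he p) p).symm.trans (sliceChart (e q) (he q) q)).source,
        (u, (0 : N)) ∈ (e p).target ∧ (e p).symm (u, 0) ∈ (e q).source := by
      intro u hu
      have h2 : (u, (0 : N)) ∈ (e p).target := hu.1
      refine ⟨h2, ?_⟩
      have h3 : (((sliceChart (e p) (he p) p).symm u : S) : E) ∈ (e q).source := hu.2
      rwa [coe_sliceChart_symm _ _ _ h2] at h3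
    refine (h1.mono fun u hu ↦ key u hu.1).congr fun u hu ↦ ?_
    change (e q (((sliceChart (e p) (he p) p).symm u : S) : E)).1 = _
    rw [coe_sliceChart_symm _ _ _ (key u hu.1).1]
  refine ⟨cs, hM, ?_, IsEmbedding.subtypeVal⟩
  suffices h : Manifold.IsImmersionOfComplement N 𝓘(ℝ, K) 𝓘(ℝ, E) ∞ (Subtype.val : S → E) from
    h.isImmersion
  intro p
  -- The slice chart followed by `L` serves as chart of `E`; against it the inclusion reads u ↦ L
  -- (u, 0).
  refine Manifold.IsImmersionAtOfComplement.mk_of_continuousAt continuous_subtype_val.continuousAt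
    L (chartAt K p) ((e p).trans L.toHomeomorph.toOpenPartialHomeomorph) (mem_chart_source K p)
    (by simpa using hmem p) (IsManifold.chart_mem_maximalAtlas p) ?_ ?_
  · rw [IsManifold.mem_maximalAtlas_iff_contMDiffOn]
    simp only [contMDiffOn_iff_contDiffOn]
    constructor
    · refine L.contDiff.comp_contDiffOn ((hs p).mono ?_)
      intro y hy
      exact hy.1
    · refine (hs' p).comp (L.symm.contDiff.contDiffOn) ?_
      intro y hy
      exact hy.2
  · intro u hu
    have hu' : (u, (0 : N)) ∈ (e p).target := hu.2
    change L (e p (((sliceChart (e p) (he p) p).symm u : S) : E)) = L (u, 0)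
    rw [coe_sliceChart_symm _ _ _ hu', (e p).right_inv hu']

end SliceCharts

/-! ### Trace, spectrum and unitary equivalence -/

section Trace

variable {H : Type*} [NormedAddCommGroup H] [InnerProductSpace ℂ H]

theorem opTrace_add (A B : H →L[ℂ] H) : opTrace (A + B) = opTrace A + opTrace B := by
  simp [opTrace]

theorem opTrace_sub (A B : H →L[ℂ] H) : opTrace (A - B) = opTrace A - opTrace B := by
  simp [opTrace]

theorem opTrace_smul (c : ℂ) (A : H →L[ℂ] H) : opTrace (c • A) = c * opTrace A := by
  simp [opTrace]

theorem opTrace_mul_comm (A B : H →L[ℂ] H) : opTrace (A * B) = opTrace (B * A) :=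
  LinearMap.trace_mul_comm ℂ (A : H →ₗ[ℂ] H) (B : H →ₗ[ℂ] H)

variable [FiniteDimensional ℂ H] [CompleteSpace H]

theorem opTrace_star (A : H →L[ℂ] H) : opTrace (star A) = star (opTrace A) := by
  rw [opTrace, opTrace, LinearMap.trace_eq_sum_inner _ (stdOrthonormalBasis ℂ H),
    LinearMap.trace_eq_sum_inner _ (stdOrthonormalBasis ℂ H), star_sum]
  refine Finset.sum_congr rfl fun i _ ↦ ?_
  rw [ContinuousLinearMap.coe_coe, ContinuousLinearMap.coe_coe,
    ContinuousLinearMap.star_eq_adjoint, ContinuousLinearMap.adjoint_inner_right]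
  exact (inner_conj_symm _ _).symm

/-- For self-adjoint C, Tr(C²) = Tr(C†C) is the sum of ‖C eᵢ‖² over an orthonormal basis. -/
theorem eq_zero_of_opTrace_mul_self {C : H →L[ℂ] H} (hC : star C = C)
    (h : opTrace (C * C) = 0) : C = 0 := by
  have key : opTrace (C * C) = ((∑ i, ‖C (stdOrthonormalBasis ℂ H i)‖ ^ 2 : ℝ) : ℂ) := by
    rw [opTrace, LinearMap.trace_eq_sum_inner _ (stdOrthonormalBasis ℂ H), Complex.ofReal_sum]
    refine Finset.sum_congr rfl fun i _ ↦ ?_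
    nth_rw 1 [← hC]
    rw [ContinuousLinearMap.coe_coe, mul_apply_eq_comp,
      ContinuousLinearMap.star_eq_adjoint, ContinuousLinearMap.adjoint_inner_right,
      inner_self_eq_norm_sq_to_K]
    simp
  rw [key, Complex.ofReal_eq_zero, Finset.sum_eq_zero_iff_of_nonneg fun i _ ↦ by positivity] at h
  have h' : (C : H →ₗ[ℂ] H) = 0 := (stdOrthonormalBasis ℂ H).toBasis.ext fun i ↦ by
    simpa using h i (Finset.mem_univ i)
  exact ContinuousLinearMap.coe_injective h'

theorem opTrace_mul_im_eq_zero (A B : HermitianOp H) :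
    (opTrace ((A : H →L[ℂ] H) * (B : H →L[ℂ] H))).im = 0 := by
  have h := opTrace_star ((A : H →L[ℂ] H) * (B : H →L[ℂ] H))
  have hA : star (A : H →L[ℂ] H) = A := A.2
  have hB : star (B : H →L[ℂ] H) = B := B.2
  rw [star_mul, hA, hB, opTrace_mul_comm] at h
  exact Complex.conj_eq_iff_im.1 h.symm

/-- The ordered eigenvalue lists agree, so the unitary carrying the eigenbasis of B to that of A
intertwines the two operators. -/
theorem exists_unitary_conj_of_charpoly_eq {A B : H →L[ℂ] H} (hA : star A = A) (hB : star B = B)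
    (h : (A : H →ₗ[ℂ] H).charpoly = (B : H →ₗ[ℂ] H).charpoly) :
    ∃ U ∈ unitary (H →L[ℂ] H), A = U * B * star U := by
  have hA' : (A : H →ₗ[ℂ] H).IsSymmetric := (ContinuousLinearMap.isSelfAdjoint_iff_isSymmetric).1 hA
  have hB' : (B : H →ₗ[ℂ] H).IsSymmetric := (ContinuousLinearMap.isSelfAdjoint_iff_isSymmetric).1 hB
  have hev := (hA'.eigenvalues_eq_eigenvalues_iff rfl hB' rfl).2 h
  let e := (hB'.eigenvectorBasis rfl).equiv (hA'.eigenvectorBasis rfl) (Equiv.refl _)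
  let U : unitary (H →L[ℂ] H) := Unitary.linearIsometryEquiv.symm e
  refine ⟨U, U.2, ?_⟩
  have hU : A * (U : H →L[ℂ] H) = U * B := by
    apply ContinuousLinearMap.coe_injective
    refine (hB'.eigenvectorBasis rfl).toBasis.ext fun i ↦ ?_
    have h1 : (U : H →L[ℂ] H) (hB'.eigenvectorBasis rfl i) = hA'.eigenvectorBasis rfl i := by
      change e _ = _
      simp [e]
    simp [h1, hev]
  rw [← hU, mul_assoc, Unitary.mul_star_self_of_mem U.2, mul_one]

theorem charpoly_unitary_conj {U : H →L[ℂ] H} (hU : U ∈ unitary (H →L[ℂ] H)) (A : H →L[ℂ] H) :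
    ((U * A * star U : H →L[ℂ] H) : H →ₗ[ℂ] H).charpoly = (A : H →ₗ[ℂ] H).charpoly := by
  rw [← LinearEquiv.charpoly_conj (Unitary.linearIsometryEquiv ⟨U, hU⟩).toLinearEquiv
    (A : H →ₗ[ℂ] H)]
  rfl

theorem mem_unitaryOrbit_iff {ρ₀ : HermitianOp H} (hρ₀ : IsDensityOperator ρ₀)
    (ρ : HermitianOp H) : ρ ∈ unitaryOrbit ρ₀ ↔ IsDensityOperator ρ ∧
      ((ρ : H →L[ℂ] H) : H →ₗ[ℂ] H).charpoly = ((ρ₀ : H →L[ℂ] H) : H →ₗ[ℂ] H).charpoly := by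
  constructor
  · rintro ⟨U, hU, h⟩
    refine ⟨⟨?_, ?_⟩, ?_⟩
    · rw [h]
      exact hρ₀.1.conj_adjoint U
    · rw [h, opTrace_mul_comm, ← mul_assoc, Unitary.star_mul_self_of_mem hU, one_mul]
      exact hρ₀.2
    · rw [h, charpoly_unitary_conj hU]
  · rintro ⟨-, h⟩
    exact exists_unitary_conj_of_charpoly_eq ρ.2 ρ₀.2 h

end Trace

/-! ### First-order expansion of polynomials -/

section PolynomialExpansion

open Polynomial

/-- First order expansion of a polynomial at an element of a topological algebra along the
elements commuting with it. -/
theorem Polynomial.exists_aeval_add_eq {𝕜 R : Type*} [CommRing 𝕜] [Ring R] [Algebra 𝕜 R]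
    [TopologicalSpace R] [IsTopologicalRing R] (P : 𝕜[X]) (A : R) :
    ∃ Q : R → R, Continuous Q ∧ Q 0 = aeval A (derivative P) ∧
      ∀ Y, Commute A Y → aeval (A + Y) P = aeval A P + Y * Q Y := by
  induction P using Polynomial.induction_on with
  | C a => exact ⟨fun _ ↦ 0, continuous_const, by simp, fun Y _ ↦ by simp⟩
  | add P P' h h' =>
    obtain ⟨Q, hQ, hQ0, hQY⟩ := h
    obtain ⟨Q', hQ', hQ0', hQY'⟩ := h'
    refine ⟨fun Y ↦ Q Y + Q' Y, hQ.add hQ', by simp [hQ0, hQ0'], fun Y hY ↦ ?_⟩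
    rw [map_add, map_add, hQY Y hY, hQY' Y hY]
    noncomm_ring
  | monomial n a h =>
    obtain ⟨Q, hQ, hQ0, hQY⟩ := h
    have hX : (C a * X ^ (n + 1) : 𝕜[X]) = C a * X ^ n * X := by ring
    -- With f = aXⁿ, expand (f(A) + Y Q(Y))(A + Y) and move Y to the left of f(A), with which it
    -- commutes.
    refine ⟨fun Y ↦ aeval A (C a * X ^ n) + Q Y * (A + Y), by fun_prop, ?_, fun Y hY ↦ ?_⟩
    · simp only [hX, derivative_mul (g := X), derivative_X, mul_one, map_add, hQ0,
        map_mul (aeval A) (derivative (C a * X ^ n)) X, aeval_X, add_zero]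
      rw [add_comm]
    · have hc : Commute (aeval A (C a * X ^ n)) Y := by
        simp only [map_mul, aeval_C, map_pow, aeval_X]
        exact Commute.mul_left (Algebra.commutes a Y) (hY.pow_left n)
      rw [hX, map_mul (aeval (A + Y)), map_mul (aeval A) _ X, hQY Y hY, aeval_X, aeval_X, add_mul,
        mul_add, hc.eq]
      noncomm_ring

end PolynomialExpansion

/-- The derivative of a product of three functions with values in a normed algebra. -/
theorem HasFDerivAt.mul_mul {V A : Type*} [NormedAddCommGroup V] [NormedSpace ℝ V] [NormedRing A]
    [NormedAlgebra ℝ A] {u v w : V → A} {u' v' w' f' : V →L[ℝ] A} {x : V}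
    (hu : HasFDerivAt u u' x) (hv : HasFDerivAt v v' x) (hw : HasFDerivAt w w' x)
    (h : ∀ z, f' z = u' z * v x * w x + u x * v' z * w x + u x * v x * w' z) :
    HasFDerivAt (fun y ↦ u y * v y * w y) f' x := by
  refine ((hu.mul' hv).mul' hw).congr_fderiv (ContinuousLinearMap.ext fun z ↦ ?_)
  simp [h]
  noncomm_ring

/-! ### Conjugation and exponentials of Hermitian operators -/

section HermitianOp

variable {H : Type*} [NormedAddCommGroup H] [InnerProductSpace ℂ H] [CompleteSpace H]

/-- Conjugation of a Hermitian operator, `A ↦ U A U†`. -/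
noncomputable def conjOp (U : H →L[ℂ] H) : HermitianOp H →L[ℝ] HermitianOp H where
  toFun A := ⟨U * (A : H →L[ℂ] H) * star U, by
    have hA : star (A : H →L[ℂ] H) = A := A.2
    change star _ = _
    rw [star_mul, star_mul, star_star, hA, mul_assoc]⟩
  map_add' A B := Subtype.ext (by simp [mul_add, add_mul])
  map_smul' c A := Subtype.ext (by simp)
  cont := by fun_prop

@[simp]
theorem coe_conjOp (U : H →L[ℂ] H) (A : HermitianOp H) :
    (conjOp U A : H →L[ℂ] H) = U * (A : H →L[ℂ] H) * star U := rfl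

theorem conjOp_mul (U V : H →L[ℂ] H) (A : HermitianOp H) :
    conjOp (U * V) A = conjOp U (conjOp V A) :=
  Subtype.ext (by simp [mul_assoc])

theorem conjOp_star_conjOp {U : H →L[ℂ] H} (hU : U ∈ unitary (H →L[ℂ] H)) (A : HermitianOp H) :
    conjOp (star U) (conjOp U A) = A := by
  rw [← conjOp_mul, Unitary.star_mul_self_of_mem hU]
  exact Subtype.ext (by simp)

theorem conjOp_conjOp_star {U : H →L[ℂ] H} (hU : U ∈ unitary (H →L[ℂ] H)) (A : HermitianOp H) :
    conjOp U (conjOp (star U) A) = A := by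
  simpa using conjOp_star_conjOp (Unitary.star_mem hU) A

theorem mem_unitaryOrbit {ρ₀ ρ : HermitianOp H} :
    ρ ∈ unitaryOrbit ρ₀ ↔ ∃ U ∈ unitary (H →L[ℂ] H), ρ = conjOp U ρ₀ := by
  simp only [Subtype.ext_iff]
  rfl

theorem conjOp_mem_unitaryOrbit {ρ₀ : HermitianOp H} {U : H →L[ℂ] H}
    (hU : U ∈ unitary (H →L[ℂ] H)) (A : HermitianOp H) :
    conjOp U A ∈ unitaryOrbit ρ₀ ↔ A ∈ unitaryOrbit ρ₀ := by
  simp only [mem_unitaryOrbit]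
  constructor
  · rintro ⟨V, hV, h⟩
    exact ⟨star U * V, mul_mem (Unitary.star_mem hU) hV, by
      rw [conjOp_mul, ← h, conjOp_star_conjOp hU]⟩
  · rintro ⟨V, hV, rfl⟩
    exact ⟨U * V, mul_mem hU hV, (conjOp_mul _ _ _).symm⟩

/-- The linear map `A ↦ (1 / iħ) [A, ρ]`. -/
noncomputable def tangentOpL (hbar : ℝ) (ρ : HermitianOp H) : HermitianOp H →ₗ[ℝ] HermitianOp H where
  toFun A := tangentOp hbar A ρ
  map_add' A B := Subtype.ext (by
    simp only [tangentOp, opCommutator, Submodule.coe_add, add_mul, mul_add, ← smul_add]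
    congr 1
    abel)
  map_smul' c A := Subtype.ext (by
    simp only [tangentOp, opCommutator, Submodule.coe_smul, smul_mul_assoc, mul_smul_comm,
      ← smul_sub, RingHom.id_apply]
    exact smul_comm _ _ _)

@[simp]
theorem tangentOpL_apply (hbar : ℝ) (ρ A : HermitianOp H) :
    tangentOpL hbar ρ A = tangentOp hbar A ρ := rfl

theorem commute_of_tangentOp_eq_zero {hbar : ℝ} (hh : hbar ≠ 0) {A ρ : HermitianOp H}
    (h : tangentOp hbar A ρ = 0) : Commute (A : H →L[ℂ] H) (ρ : H →L[ℂ] H) := by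
  have h1 : (1 / (Complex.I * hbar)) • opCommutator (A : H →L[ℂ] H) (ρ : H →L[ℂ] H) = 0 :=
    congrArg Subtype.val h
  rw [smul_eq_zero] at h1
  exact sub_eq_zero.1 (h1.resolve_left (by simp [hh]))

/-- The real linear map `X ↦ X / iħ` from Hermitian to skew-adjoint operators. -/
noncomputable def divIHbar (hbar : ℝ) : HermitianOp H →L[ℝ] (H →L[ℂ] H) :=
  ((1 / (Complex.I * hbar)) • ContinuousLinearMap.id ℂ (H →L[ℂ] H)).restrictScalars ℝ ∘L
    (HermitianOp H).subtypeL

theorem divIHbar_apply (hbar : ℝ) (X : HermitianOp H) :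
    divIHbar hbar X = (1 / (Complex.I * hbar)) • (X : H →L[ℂ] H) := rfl

theorem coe_tangentOp (hbar : ℝ) (A ρ : HermitianOp H) :
    (tangentOp hbar A ρ : H →L[ℂ] H) =
      divIHbar hbar A * (ρ : H →L[ℂ] H) - (ρ : H →L[ℂ] H) * divIHbar hbar A := by
  simp [tangentOp, opCommutator, divIHbar_apply, smul_sub]

theorem star_divIHbar (hbar : ℝ) (X : HermitianOp H) :
    star (divIHbar hbar X) = -divIHbar hbar X := by
  have hX : star (X : H →L[ℂ] H) = X := X.2
  rw [divIHbar_apply, star_smul, hX, ← neg_smul]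
  congr 1
  simp

/-- The unitary operator `exp (X / iħ)`. -/
noncomputable def expHermitian (hbar : ℝ) (X : HermitianOp H) : H →L[ℂ] H :=
  NormedSpace.exp (divIHbar hbar X)

theorem star_expHermitian (hbar : ℝ) (X : HermitianOp H) :
    star (expHermitian hbar X) = expHermitian hbar (-X) := by
  rw [expHermitian, expHermitian, NormedSpace.star_exp, star_divIHbar, map_neg]

@[simp]
theorem expHermitian_zero (hbar : ℝ) : expHermitian hbar (0 : HermitianOp H) = 1 := by
  simp [expHermitian]

theorem expHermitian_mem_unitary (hbar : ℝ) (X : HermitianOp H) :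
    expHermitian hbar X ∈ unitary (H →L[ℂ] H) := by
  let +nondep : NormedAlgebra ℚ (H →L[ℂ] H) := .restrictScalars ℚ ℂ _
  exact NormedSpace.exp_mem_unitary_of_mem_skewAdjoint
    (by rw [skewAdjoint.mem_iff]; exact star_divIHbar hbar X)

theorem contDiff_expHermitian (hbar : ℝ) :
    ContDiff ℝ ∞ (expHermitian hbar : HermitianOp H → H →L[ℂ] H) := by
  have h : ContDiff ℝ ∞ (NormedSpace.exp : (H →L[ℂ] H) → (H →L[ℂ] H)) :=
    contDiff_iff_contDiffAt.2 fun x ↦ (NormedSpace.exp_analytic (𝕂 := ℝ) x).contDiffAt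
  exact h.comp (divIHbar (H := H) hbar).contDiff

theorem hasFDerivAt_expHermitian_zero (hbar : ℝ) :
    HasFDerivAt (expHermitian hbar) (divIHbar hbar) (0 : HermitianOp H) := by
  have h : HasFDerivAt (NormedSpace.exp : (H →L[ℂ] H) → (H →L[ℂ] H))
      (1 : (H →L[ℂ] H) →L[ℝ] (H →L[ℂ] H)) (divIHbar hbar (0 : HermitianOp H)) := by
    rw [map_zero]
    exact hasFDerivAt_exp_zero
  exact h.comp (0 : HermitianOp H) (divIHbar (H := H) hbar).hasFDerivAt

/-- The map `(X, Y) ↦ exp (X / iħ) (ρ + Y) exp (X / iħ)†`. -/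
noncomputable def conjExp (hbar : ℝ) (ρ : HermitianOp H) (z : HermitianOp H × HermitianOp H) :
    HermitianOp H :=
  conjOp (expHermitian hbar z.1) (ρ + z.2)

variable [FiniteDimensional ℂ H]

/-- Lets smoothness and derivatives of Hermitian-valued maps be checked in the full operator
algebra, where products are available. -/
theorem exists_retraction_hermitianOp :
    ∃ P : (H →L[ℂ] H) →L[ℝ] HermitianOp H, ∀ A : HermitianOp H, P A = A :=
  Submodule.ClosedComplemented.of_finiteDimensional (HermitianOp H)

theorem contDiff_of_coe {V : Type*} [NormedAddCommGroup V] [NormedSpace ℝ V]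
    {f : V → HermitianOp H} (hf : ContDiff ℝ ∞ fun x ↦ (f x : H →L[ℂ] H)) : ContDiff ℝ ∞ f := by
  obtain ⟨P, hP⟩ := exists_retraction_hermitianOp (H := H)
  have h2 : (P ∘ fun x ↦ (f x : H →L[ℂ] H)) = f := funext fun y ↦ hP (f y)
  exact h2 ▸ P.contDiff.comp hf

theorem hasFDerivAt_of_coe {V : Type*} [NormedAddCommGroup V] [NormedSpace ℝ V]
    {f : V → HermitianOp H} {f' : V →L[ℝ] HermitianOp H} {x : V}
    (hf : HasFDerivAt (fun x ↦ (f x : H →L[ℂ] H)) ((HermitianOp H).subtypeL ∘L f') x) :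
    HasFDerivAt f f' x := by
  obtain ⟨P, hP⟩ := exists_retraction_hermitianOp (H := H)
  have h := P.hasFDerivAt.comp x hf
  have h1 : P ∘L ((HermitianOp H).subtypeL ∘L f') = f' := by
    ext1 v
    simp [hP]
  have h2 : (P ∘ fun x ↦ (f x : H →L[ℂ] H)) = f := funext fun y ↦ hP (f y)
  rwa [h1, h2] at h

theorem contDiff_conjExp (hbar : ℝ) (ρ : HermitianOp H) : ContDiff ℝ ∞ (conjExp hbar ρ) := by
  refine contDiff_of_coe ?_
  simp only [conjExp, coe_conjOp, star_expHermitian]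
  have h := contDiff_expHermitian (H := H) hbar
  exact ((h.comp contDiff_fst).mul ((HermitianOp H).subtypeL.contDiff.comp
    (contDiff_const.add contDiff_snd))).mul (h.comp contDiff_fst.neg)

/-- The product rule, with exp(X/iħ)† rewritten as exp(−X/iħ): the two outer factors contribute the
two halves of the commutator. -/
theorem hasFDerivAt_conjExp (hbar : ℝ) (ρ : HermitianOp H) :
    HasFDerivAt (conjExp hbar ρ)
      ((tangentOpL hbar ρ).toContinuousLinearMap.coprod (ContinuousLinearMap.id ℝ _)) 0 := by
  refine hasFDerivAt_of_coe ?_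
  simp only [conjExp, coe_conjOp, star_expHermitian]
  have h0 := hasFDerivAt_expHermitian_zero (H := H) hbar
  have h1 : HasFDerivAt (fun z : HermitianOp H × HermitianOp H ↦ expHermitian hbar z.1)
      (divIHbar hbar ∘L ContinuousLinearMap.fst ℝ _ _) 0 :=
    HasFDerivAt.comp (g := expHermitian hbar)
      (f := fun z : HermitianOp H × HermitianOp H ↦ z.1) 0 h0 hasFDerivAt_fst
  have h2 : HasFDerivAt (fun z : HermitianOp H × HermitianOp H ↦ expHermitian hbar (-z.1))
      (divIHbar hbar ∘L (-ContinuousLinearMap.fst ℝ _ _)) 0 := by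
    refine HasFDerivAt.comp (g := expHermitian hbar)
      (f := fun z : HermitianOp H × HermitianOp H ↦ -z.1) 0 ?_ hasFDerivAt_fst.neg
    rw [Prod.fst_zero, neg_zero]
    exact h0
  have h3 : HasFDerivAt (fun z : HermitianOp H × HermitianOp H ↦ ((ρ + z.2 : HermitianOp H) :
      H →L[ℂ] H)) ((HermitianOp H).subtypeL ∘L ContinuousLinearMap.snd ℝ _ _) 0 :=
    (HermitianOp H).subtypeL.hasFDerivAt.comp 0 (hasFDerivAt_snd.const_add ρ)
  refine h1.mul_mul h3 h2 fun z ↦ ?_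
  have h4 : expHermitian hbar (0 : HermitianOp H × HermitianOp H).1 = 1 := expHermitian_zero hbar
  have h5 : expHermitian hbar (-(0 : HermitianOp H × HermitianOp H).1) = 1 := by
    rw [Prod.fst_zero, neg_zero, expHermitian_zero]
  have h6 : ρ + (0 : HermitianOp H × HermitianOp H).2 = ρ := add_zero ρ
  rw [h4, h5, h6]
  change ((tangentOp hbar z.1 ρ : HermitianOp H) : H →L[ℂ] H) + (z.2 : H →L[ℂ] H) =
    divIHbar hbar z.1 * (ρ : H →L[ℂ] H) * 1 + 1 * (z.2 : H →L[ℂ] H) * 1 +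
      1 * (ρ : H →L[ℂ] H) * divIHbar hbar (-z.1)
  rw [coe_tangentOp, map_neg, mul_one, mul_one, one_mul, one_mul, mul_neg]
  abel

end HermitianOp

/-! ### Inverse function theorem and linear splitting -/

/-- Inverse function theorem, producing a local inverse which is smooth on an open set and takes
values in a prescribed neighborhood. -/
theorem ContDiff.exists_smooth_local_inverse {V W : Type*} [NormedAddCommGroup V] [NormedSpace ℝ V]
    [CompleteSpace V] [NormedAddCommGroup W] [NormedSpace ℝ W] {f : V → W} (hf : ContDiff ℝ ∞ f)
    {x : V} {D : V ≃L[ℝ] W} (hD : HasFDerivAt f (D : V →L[ℝ] W) x) {s : Set V} (hs : s ∈ 𝓝 x) :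
    ∃ e : OpenPartialHomeomorph W V, f x ∈ e.source ∧ ContDiffOn ℝ ∞ e e.source ∧
      ContDiffOn ℝ ∞ e.symm e.target ∧ (∀ z, e.symm z = f z) ∧ e.target ⊆ s := by
  obtain ⟨t, hts, ht, hxt⟩ := mem_nhds_iff.1 hs
  let e₀ := hf.contDiffAt.toOpenPartialHomeomorph f hD (by simp)
  -- Restricting to the open locus of invertible derivative makes the inverse smooth on its whole
  -- source, not only at `f x`.
  let O : Set V := {z | fderiv ℝ f z ∈ range ((↑) : (V ≃L[ℝ] W) → V →L[ℝ] W)} ∩ t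
  have hO : IsOpen O :=
    (ContinuousLinearEquiv.isOpen.preimage (hf.continuous_fderiv (by simp))).inter ht
  have hxO : x ∈ O := ⟨⟨D, hD.fderiv.symm⟩, hxt⟩
  let e := e₀.restrOpen O hO
  have he : ∀ z, e z = f z := fun z ↦ rfl
  have hx : x ∈ e.source := ⟨hf.contDiffAt.mem_toOpenPartialHomeomorph_source hD (by simp), hxO⟩
  refine ⟨e.symm, e.map_source hx, fun y hy ↦ ?_, hf.contDiffOn, he,
    fun z hz ↦ hts (show z ∈ e₀.source ∩ O from hz).2.2⟩
  have hz : e.symm y ∈ e₀.source ∩ O := e.map_target hy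
  obtain ⟨D', hD'⟩ := hz.2.1
  refine (e.contDiffAt_symm (f₀' := D') hy ?_ hf.contDiffAt).contDiffWithinAt
  rw [hD']
  exact (hf.differentiable (by simp) _).hasFDerivAt

/-- A linear endomorphism whose kernel meets its range trivially identifies the space with the
product of its range and its kernel. -/
theorem LinearMap.exists_range_prod_ker_equiv {V : Type*} [NormedAddCommGroup V] [NormedSpace ℝ V]
    [FiniteDimensional ℝ V] (T : V →ₗ[ℝ] V) (hT : ∀ v, T (T v) = 0 → T v = 0) :
    ∃ D : (T.range × T.ker) ≃L[ℝ] V, ∀ z, D z = T z.1 + z.2 := by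
  let f : (T.range × T.ker) →ₗ[ℝ] V := (T ∘ₗ T.range.subtype).coprod T.ker.subtype
  have hf : ∀ z, f z = T z.1 + z.2 := fun z ↦ rfl
  have hinj : Function.Injective f := by
    rw [injective_iff_map_eq_zero]
    rintro ⟨⟨_, ⟨v, rfl⟩⟩, ⟨w, hw⟩⟩ h0
    rw [hf] at h0
    have h1 : T (T (T v)) = 0 := by
      rw [eq_neg_of_add_eq_zero_left h0, map_neg, LinearMap.mem_ker.1 hw, neg_zero]
    have h2 := hT _ h1
    have h0' : T (T v) + w = 0 := h0
    rw [h2, zero_add] at h0'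
    exact Prod.ext (Subtype.ext (hT _ h2)) (Subtype.ext h0')
  have hdim : Module.finrank ℝ (T.range × T.ker) = Module.finrank ℝ V := by
    rw [Module.finrank_prod, LinearMap.finrank_range_add_finrank_ker]
  exact ⟨(LinearEquiv.ofInjectiveOfFinrankEq f hinj hdim).toContinuousLinearEquiv, hf⟩

/-- Restricted to range T × ker T, the differential (u, v) ↦ Tu + v is invertible. The set `s`
carries the smallness condition needed later. -/
theorem exists_slice_of_hasFDerivAt {V : Type*} [NormedAddCommGroup V] [NormedSpace ℝ V]
    [FiniteDimensional ℝ V] {Φ : V × V → V} (hΦ : ContDiff ℝ ∞ Φ) (T : V →ₗ[ℝ] V)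
    (hT : ∀ v, T (T v) = 0 → T v = 0)
    (hD : HasFDerivAt Φ (T.toContinuousLinearMap.coprod (ContinuousLinearMap.id ℝ V)) 0)
    {s : Set (V × V)} (hs : s ∈ 𝓝 0) :
    ∃ e : OpenPartialHomeomorph V (T.range × T.ker), Φ 0 ∈ e.source ∧ ContDiffOn ℝ ∞ e e.source ∧
      ContDiffOn ℝ ∞ e.symm e.target ∧ (∀ z, e.symm z = Φ (z.1, z.2)) ∧
      ∀ z ∈ e.target, ((z.1 : V), (z.2 : V)) ∈ s := by
  have : CompleteSpace V := FiniteDimensional.complete ℝ V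
  obtain ⟨D, hDz⟩ := T.exists_range_prod_ker_equiv hT
  let j : (T.range × T.ker) →L[ℝ] V × V := T.range.subtypeL.prodMap T.ker.subtypeL
  have hf' : HasFDerivAt (Φ ∘ j) (D : _ →L[ℝ] V) 0 := by
    rw [← map_zero j] at hD
    refine (hD.comp 0 j.hasFDerivAt).congr_fderiv (ContinuousLinearMap.ext fun z ↦ ?_)
    exact (hDz z).symm
  have hs' : j ⁻¹' s ∈ 𝓝 0 := j.continuous.continuousAt.preimage_mem_nhds (by rwa [map_zero])
  obtain ⟨e, hx, he, he', hsymm, htarget⟩ :=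
    (hΦ.comp j.contDiff).exists_smooth_local_inverse hf' hs'
  rw [Function.comp_apply, map_zero] at hx
  exact ⟨e, hx, he, he', hsymm, fun z hz ↦ htarget hz⟩

/-! ### The slice at the base point -/

section Slice

variable {H : Type*} [NormedAddCommGroup H] [InnerProductSpace ℂ H] [CompleteSpace H]

theorem opTrace_tangentOp_mul (hbar : ℝ) (A B ρ : HermitianOp H) :
    opTrace ((tangentOp hbar A ρ : H →L[ℂ] H) * (B : H →L[ℂ] H)) =
      -opTrace ((A : H →L[ℂ] H) * (tangentOp hbar B ρ : H →L[ℂ] H)) := by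
  simp only [tangentOp, opCommutator, smul_mul_assoc, mul_smul_comm, opTrace_smul, sub_mul,
    mul_sub, opTrace_sub]
  rw [mul_assoc (ρ : H →L[ℂ] H), opTrace_mul_comm (ρ : H →L[ℂ] H), mul_assoc, mul_assoc]
  ring

variable [FiniteDimensional ℂ H]

/-- Skewness gives Tr((TA)²) = −Tr(A·T²A) = 0. -/
theorem tangentOp_eq_zero_of_tangentOp_tangentOp_eq_zero {hbar : ℝ} {A ρ : HermitianOp H}
    (h : tangentOp hbar (tangentOp hbar A ρ) ρ = 0) : tangentOp hbar A ρ = 0 := by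
  refine Subtype.ext (eq_zero_of_opTrace_mul_self (tangentOp hbar A ρ).2 ?_)
  rw [opTrace_tangentOp_mul, h]
  simp [opTrace]

/-- Hermitian perturbations commuting with `ρ` leave the orbit of `ρ`. -/
theorem eventually_eq_zero_of_add_mem_unitaryOrbit (ρ : HermitianOp H) :
    ∀ᶠ Y : HermitianOp H in 𝓝 0, Commute (Y : H →L[ℂ] H) (ρ : H →L[ℂ] H) →
      ρ + Y ∈ unitaryOrbit ρ → Y = 0 := by
  have hsymm : ((ρ : H →L[ℂ] H) : H →ₗ[ℂ] H).IsSymmetric :=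
    ContinuousLinearMap.isSelfAdjoint_iff_isSymmetric.1 ρ.2
  let P := minpoly ℂ ((ρ : H →L[ℂ] H) : H →ₗ[ℂ] H)
  -- Self-adjoint operators are semisimple, so P is squarefree, hence separable: aP + bP′ = 1.
  have hsq : Squarefree P := (Module.End.isFinitelySemisimple_iff_isSemisimple.1
    hsymm.isFinitelySemisimple).minpoly_squarefree
  obtain ⟨a, b, hab⟩ := (PerfectField.separable_iff_squarefree.2 hsq : P.Separable)
  have hP : Polynomial.aeval (ρ : H →L[ℂ] H) P = 0 := by
    have h1 := Polynomial.aeval_algHom_apply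
      (Module.End.toContinuousLinearMap H).toAlgHom ((ρ : H →L[ℂ] H) : H →ₗ[ℂ] H) P
    rw [minpoly.aeval, map_zero] at h1
    exact h1
  obtain ⟨Q, hQ, hQ0, hQY⟩ := P.exists_aeval_add_eq (ρ : H →L[ℂ] H)
  -- Q(0) = P′(ρ), which is inverted by b(ρ) since P(ρ) = 0.
  have hunit : IsUnit (Q 0) := by
    rw [hQ0]
    have h1 := congrArg (Polynomial.aeval (ρ : H →L[ℂ] H)) hab
    rw [map_add, map_mul, map_mul, hP, mul_zero, zero_add, map_one] at h1
    have h2 := h1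
    rw [← map_mul, mul_comm, map_mul] at h2
    exact ⟨⟨_, _, h2, h1⟩, rfl⟩
  have hev : ∀ᶠ Y : HermitianOp H in 𝓝 0, IsUnit (Q (Y : H →L[ℂ] H)) :=
    (hQ.comp continuous_subtype_val).continuousAt.eventually_mem
      (Units.isOpen.mem_nhds (x := Q ((0 : HermitianOp H) : H →L[ℂ] H)) hunit)
  filter_upwards [hev] with Y hY hcomm ⟨U, hU, hUY⟩
  -- Being conjugate to ρ, ρ + Y is also a root of P; the expansion then leaves Y Q(Y) = 0 with Q(Y)
  -- invertible.
  have h1 : Polynomial.aeval ((ρ : H →L[ℂ] H) + (Y : H →L[ℂ] H)) P = 0 := by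
    have h2 := Polynomial.aeval_algHom_apply
      (Unitary.conjStarAlgAut ℂ (H →L[ℂ] H) ⟨U, hU⟩) (ρ : H →L[ℂ] H) P
    rw [hP, map_zero, Unitary.conjStarAlgAut_apply] at h2
    rw [← h2]
    exact congrArg (fun z ↦ Polynomial.aeval z P) hUY
  rw [hQY _ hcomm.symm, hP, zero_add, hY.mul_left_eq_zero] at h1
  exact Subtype.ext h1

/-- A smooth slice chart of the orbit of `ρ` around `ρ`. -/
theorem exists_slice_unitaryOrbit {hbar : ℝ} (hh : hbar ≠ 0) (ρ : HermitianOp H) :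
    ∃ e : OpenPartialHomeomorph (HermitianOp H)
        ((tangentOpL hbar ρ).range × (tangentOpL hbar ρ).ker),
      ρ ∈ e.source ∧ ContDiffOn ℝ ∞ e e.source ∧ ContDiffOn ℝ ∞ e.symm e.target ∧
      (∀ z, e.symm z = conjExp hbar ρ (z.1, z.2)) ∧
      ∀ y ∈ e.source, y ∈ unitaryOrbit ρ ↔ (e y).2 = 0 := by
  have hev : ∀ᶠ z : HermitianOp H × HermitianOp H in 𝓝 0,
      Commute (z.2 : H →L[ℂ] H) (ρ : H →L[ℂ] H) → ρ + z.2 ∈ unitaryOrbit ρ → z.2 = 0 :=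
    (continuous_snd.tendsto' (0 : HermitianOp H × HermitianOp H) 0 rfl).eventually
      (eventually_eq_zero_of_add_mem_unitaryOrbit ρ)
  obtain ⟨e, hx, he, he', hsymm, htarget⟩ := exists_slice_of_hasFDerivAt (contDiff_conjExp hbar ρ)
    (tangentOpL hbar ρ) (fun A ↦ tangentOp_eq_zero_of_tangentOp_tangentOp_eq_zero)
    (hasFDerivAt_conjExp hbar ρ) hev
  have hx0 : conjExp hbar ρ 0 = ρ := by
    change conjOp (expHermitian hbar (0 : HermitianOp H)) (ρ + 0) = ρ
    exact Subtype.ext (by simp)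
  rw [hx0] at hx
  refine ⟨e, hx, he, he', hsymm, fun y hy ↦ ?_⟩
  -- Conjugation invariance reduces membership of y to that of ρ + Y, where Y ∈ ker T commutes with
  -- ρ.
  have h1 : y = conjOp (expHermitian hbar (e y).1) (ρ + ((e y).2 : HermitianOp H)) := by
    nth_rw 1 [← e.left_inv hy, hsymm]
    rfl
  have h2 := conjOp_mem_unitaryOrbit (ρ₀ := ρ)
    (expHermitian_mem_unitary hbar ((e y).1 : HermitianOp H)) (ρ + ((e y).2 : HermitianOp H))
  rw [← h1] at h2
  rw [h2]
  refine ⟨fun h ↦ Subtype.ext (htarget _ (e.map_source hy)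
    (commute_of_tangentOp_eq_zero hh (e y).2.2) h), fun h ↦ ?_⟩
  rw [h, Submodule.coe_zero, add_zero]
  exact mem_unitaryOrbit.2 ⟨1, one_mem _, Subtype.ext (by simp)⟩

end Slice

theorem ContDiffOn.coe_fst_of_submodule {V : Type*} [NormedAddCommGroup V] [NormedSpace ℝ V]
    {K N : Submodule ℝ V} {f : V → K × N} {s : Set V} (hf : ContDiffOn ℝ ∞ f s) :
    ContDiffOn ℝ ∞ (fun y ↦ ((f y).1 : V)) s :=
  K.subtypeL.contDiff.comp_contDiffOn (contDiff_fst.comp_contDiffOn hf)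

/-- A subset of a finite-dimensional space with smooth slice charts modelled on the range and the
kernel of a linear map is a smoothly embedded submanifold. -/
theorem exists_smoothEmbedding_of_range_ker_slices {V : Type*} [NormedAddCommGroup V]
    [NormedSpace ℝ V] [FiniteDimensional ℝ V] (T : V →ₗ[ℝ] V) (hT : ∀ v, T (T v) = 0 → T v = 0)
    {S : Set V} (h : ∀ p ∈ S, ∃ e : OpenPartialHomeomorph V (T.range × T.ker), p ∈ e.source ∧
      ContDiffOn ℝ ∞ e e.source ∧ ContDiffOn ℝ ∞ e.symm e.target ∧
      ∀ y ∈ e.source, y ∈ S ↔ (e y).2 = 0) :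
    ∃ (d : ℕ) (_ : ChartedSpace (EuclideanSpace ℝ (Fin d)) S),
      IsManifold 𝓘(ℝ, EuclideanSpace ℝ (Fin d)) ∞ S ∧
        Manifold.IsSmoothEmbedding 𝓘(ℝ, EuclideanSpace ℝ (Fin d)) 𝓘(ℝ, V) ∞
          (Subtype.val : S → V) := by
  -- Only the linear isomorphism range T × ker T ≃ V is needed here, not its formula.
  obtain ⟨D, -⟩ := T.exists_range_prod_ker_equiv hT
  let F := (toEuclidean (E := T.range)).prodCongr (ContinuousLinearEquiv.refl ℝ T.ker)
  choose e hmem he he' horbit using fun p : S ↦ h p p.2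
  refine ⟨_, exists_smoothEmbedding_of_sliceCharts (F.symm.trans D)
    (fun p ↦ (e p).trans F.toHomeomorph.toOpenPartialHomeomorph) ?_ ?_ ?_ ?_⟩
  · intro p
    simpa using hmem p
  · intro p y hy
    exact horbit p y hy.1
  · intro p
    exact F.contDiff.comp_contDiffOn ((he p).mono fun y hy ↦ hy.1)
  · intro p
    exact (he' p).comp F.symm.contDiff.contDiffOn fun y hy ↦ hy.2

/-! ### Orbits as submanifolds; local sections -/

section OrbitManifold

variable {H : Type*} [NormedAddCommGroup H] [InnerProductSpace ℂ H] [CompleteSpace H]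

/-- Conjugation by a unitary operator, as a linear automorphism of the Hermitian operators. -/
noncomputable def conjOpEquiv {U : H →L[ℂ] H} (hU : U ∈ unitary (H →L[ℂ] H)) :
    HermitianOp H ≃L[ℝ] HermitianOp H :=
  ContinuousLinearEquiv.equivOfInverse (conjOp U) (conjOp (star U)) (conjOp_star_conjOp hU)
    (conjOp_conjOp_star hU)

variable [FiniteDimensional ℂ H]

/-- Smooth slice charts of a unitary orbit around each of its points. -/
theorem exists_slice_unitaryOrbit_of_mem {hbar : ℝ} (hh : hbar ≠ 0) {ρ₀ p : HermitianOp H}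
    (hp : p ∈ unitaryOrbit ρ₀) :
    ∃ e : OpenPartialHomeomorph (HermitianOp H)
        ((tangentOpL hbar ρ₀).range × (tangentOpL hbar ρ₀).ker),
      p ∈ e.source ∧ ContDiffOn ℝ ∞ e e.source ∧ ContDiffOn ℝ ∞ e.symm e.target ∧
      (∀ y ∈ e.source, y ∈ unitaryOrbit ρ₀ ↔ (e y).2 = 0) ∧
      ∃ U ∈ unitary (H →L[ℂ] H), ∀ y ∈ e.source, y ∈ unitaryOrbit ρ₀ →
        y = conjOp (U * expHermitian hbar (e y).1) ρ₀ := by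
  obtain ⟨U, hU, rfl⟩ := mem_unitaryOrbit.1 hp
  obtain ⟨e, hmem, he, he', hsymm, horbit⟩ := exists_slice_unitaryOrbit hh ρ₀
  -- Transporting the slice at ρ₀ by conjugation gives all points the same model space.
  let f := (conjOpEquiv hU).symm.toHomeomorph.toOpenPartialHomeomorph.trans e
  have hf : ∀ y, f y = e (conjOp (star U) y) := fun y ↦ rfl
  have hf' : ∀ y, y ∈ f.source ↔ conjOp (star U) y ∈ e.source := fun y ↦ by
    change y ∈ univ ∩ _ ↔ _
    rw [univ_inter]
    rfl
  have key : ∀ y ∈ f.source, y ∈ unitaryOrbit ρ₀ ↔ (f y).2 = 0 := fun y hy ↦ by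
    rw [hf, ← horbit _ ((hf' y).1 hy), conjOp_mem_unitaryOrbit (Unitary.star_mem hU)]
  refine ⟨f, ?_, ?_, ?_, key, U, hU, fun y hy hmem ↦ ?_⟩
  · rw [hf', conjOp_star_conjOp hU]
    exact hmem
  · exact he.comp (conjOp (star U)).contDiff.contDiffOn fun y hy ↦ (hf' y).1 hy
  · exact (conjOp U).contDiff.comp_contDiffOn (he'.mono fun z hz ↦ hz.1)
  · have h0 : (e (conjOp (star U) y)).2 = 0 := (key y hy).1 hmem
    rw [hf, conjOp_mul]
    have h1 := e.left_inv ((hf' y).1 hy)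
    rw [hsymm, h0, conjExp] at h1
    simp only [Submodule.coe_zero, add_zero] at h1
    rw [h1, conjOp_conjOp_star hU]

/-- Unitary orbits are smoothly embedded submanifolds of the space of Hermitian operators. -/
theorem exists_isEmbeddedOrbit (ρ₀ : HermitianOp H) :
    ∃ (d : ℕ) (cs : ChartedSpace (EuclideanSpace ℝ (Fin d)) (unitaryOrbit ρ₀)),
      IsEmbeddedOrbit ρ₀ cs := by
  -- The orbit does not involve ħ, so any nonzero value serves; here ħ = 1.
  refine exists_smoothEmbedding_of_range_ker_slices (tangentOpL 1 ρ₀)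
    (fun A ↦ tangentOp_eq_zero_of_tangentOp_tangentOp_eq_zero) fun p hp ↦ ?_
  obtain ⟨e, hmem, he, he', horbit, -⟩ := exists_slice_unitaryOrbit_of_mem one_ne_zero hp
  exact ⟨e, hmem, he, he', horbit⟩

/-- Smooth local sections of the map `U ↦ U ρ₀ U†` onto a unitary orbit. -/
theorem exists_local_section_unitaryOrbit {ρ₀ p : HermitianOp H} (hp : p ∈ unitaryOrbit ρ₀) :
    ∃ (O : Set (HermitianOp H)) (W : HermitianOp H → H →L[ℂ] H), IsOpen O ∧ p ∈ O ∧
      ContDiffOn ℝ ∞ W O ∧ (∀ y, W y ∈ unitary (H →L[ℂ] H)) ∧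
      ∀ y ∈ O, y ∈ unitaryOrbit ρ₀ → y = conjOp (W y) ρ₀ := by
  obtain ⟨e, hmem, he, -, -, U, hU, h⟩ := exists_slice_unitaryOrbit_of_mem one_ne_zero hp
  refine ⟨e.source, fun y ↦ U * expHermitian 1 (e y).1, e.open_source, hmem, ?_, ?_, ?_⟩
  · have h0 := ContDiffOn.coe_fst_of_submodule he
    have h1 : ContDiffOn ℝ ∞ (fun y ↦ expHermitian 1 ((e y).1 : HermitianOp H)) e.source :=
      (contDiff_expHermitian 1).comp_contDiffOn h0
    exact ContDiffOn.mul contDiffOn_const h1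
  · exact fun y ↦ mul_mem hU (expHermitian_mem_unitary _ _)
  · exact h

end OrbitManifold

/-! ### Unitary-valued maps and the Maurer–Cartan equation -/

section UnitaryValued

variable {V A : Type*} [NormedAddCommGroup V] [NormedSpace ℝ V] [NormedRing A] [StarRing A]
  [NormedAlgebra ℝ A] {w : V → A} {w' : V →L[ℝ] A} {x : V}

/-- The `1`-form `v ↦ τ (w† (Dw) v)` associated with an operator-valued function `w` and a linear
functional `τ`. -/
noncomputable def maurerCartanForm (τ : A →L[ℝ] ℝ) (w : V → A) (y : V) : V [⋀^Fin 1]→L[ℝ] ℝ :=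
  ContinuousAlternatingMap.ofSubsingletonLIE (𝕜 := ℝ) (E := V) (F := ℝ) (0 : Fin 1)
    (τ ∘L ContinuousLinearMap.mul ℝ A (star (w y)) ∘L fderiv ℝ w y)

theorem maurerCartanForm_apply (τ : A →L[ℝ] ℝ) (w : V → A) (y : V) (v : Fin 1 → V) :
    maurerCartanForm τ w y v = τ (star (w y) * fderiv ℝ w y (v 0)) := rfl

variable [StarModule ℝ A] [ContinuousStar A]

/-- Differentiate w†w = 1. -/
theorem HasFDerivAt.star_mul_add_eq_zero (hw : HasFDerivAt w w' x)
    (hu : ∀ᶠ y in 𝓝 x, w y ∈ unitary A) (v : V) : star (w' v) * w x + star (w x) * w' v = 0 := by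
  have h1 : HasFDerivAt (fun y ↦ star (w y) * w y) (0 : V →L[ℝ] A) x :=
    (hasFDerivAt_const (1 : A) x).congr_of_eventuallyEq
      (hu.mono fun y hy ↦ Unitary.star_mul_self_of_mem hy)
  have h2 := congrArg (fun f : V →L[ℝ] A ↦ f v) (h1.unique (hw.star.mul' hw))
  simp only [zero_apply] at h2
  rw [h2]
  simp [add_comm]

/-- With a = w′w†, the derivative of w r w† is [a, w r w†], because (w′)† = −w†w′w†. -/
theorem HasFDerivAt.unitary_conj (hw : HasFDerivAt w w' x) (hu : ∀ᶠ y in 𝓝 x, w y ∈ unitary A)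
    {r : A} {f' : V →L[ℝ] A} (hf' : ∀ v, f' v = w' v * star (w x) * (w x * r * star (w x)) -
      w x * r * star (w x) * (w' v * star (w x))) :
    HasFDerivAt (fun y ↦ w y * r * star (w y)) f' x := by
  refine hw.mul_mul (hasFDerivAt_const r x) hw.star fun v ↦ ?_
  have h1 := hw.star_mul_add_eq_zero hu v
  have h2 : star (w x) * w x = 1 := Unitary.star_mul_self_of_mem hu.self_of_nhds
  have h3 : w x * star (w x) = 1 := Unitary.mul_star_self_of_mem hu.self_of_nhds
  have h4 : star (w' v) = -(star (w x) * w' v * star (w x)) := by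
    rw [← neg_mul, ← eq_neg_of_add_eq_zero_left h1, mul_assoc, h3, mul_one]
  have h5 : w' v * star (w x) * (w x * r * star (w x)) = w' v * r * star (w x) := by
    rw [mul_assoc (w' v), ← mul_assoc (star (w x)), ← mul_assoc (star (w x)), h2, one_mul,
      mul_assoc]
  rw [hf' v, h5]
  simp [h4]
  noncomm_ring

theorem contDiffOn_maurerCartanForm (τ : A →L[ℝ] ℝ) {s : Set V} (hs : IsOpen s)
    (hw : ContDiffOn ℝ ∞ w s) : ContDiffOn ℝ ∞ (maurerCartanForm τ w) s := by
  refine (ContinuousAlternatingMap.ofSubsingletonLIE (𝕜 := ℝ) (E := V) (F := ℝ)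
    (0 : Fin 1)).contDiff.comp_contDiffOn (contDiffOn_const.clm_comp (ContDiffOn.clm_comp
      ((ContinuousLinearMap.mul ℝ A).contDiff.comp_contDiffOn ?_)
      (hw.fderiv_of_isOpen hs (by simp))))
  exact (starL' ℝ : A ≃L[ℝ] A).contDiff.comp_contDiffOn hw

/-- The Maurer-Cartan equation for `v ↦ τ (w† (Dw) v)` with `w` unitary. -/
theorem extDeriv_maurerCartanForm (τ : A →L[ℝ] ℝ) {s : Set V} (hs : IsOpen s)
    (hw : ContDiffOn ℝ ∞ w s) (hu : ∀ y ∈ s, w y ∈ unitary A) (hx : x ∈ s) (v : Fin 2 → V) :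
    extDeriv (maurerCartanForm τ w) x v =
      -τ (star (w x) * (fderiv ℝ w x (v 0) * star (w x) * (fderiv ℝ w x (v 1) * star (w x)) -
        fderiv ℝ w x (v 1) * star (w x) * (fderiv ℝ w x (v 0) * star (w x))) * w x) := by
  have hsx : s ∈ 𝓝 x := hs.mem_nhds hx
  have hwx : ContDiffAt ℝ ∞ w x := hw.contDiffAt hsx
  have hw1 : HasFDerivAt w (fderiv ℝ w x) x := (hwx.differentiableAt (by simp)).hasFDerivAt
  have hw2 : HasFDerivAt (fderiv ℝ w) (fderiv ℝ (fderiv ℝ w) x) x :=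
    ((hwx.fderiv_right (m := ∞) (by simp)).differentiableAt (by simp)).hasFDerivAt
  have hsymm : IsSymmSndFDerivAt ℝ w x := by
    refine hwx.isSymmSndFDerivAt ?_
    rw [minSmoothness_of_isRCLikeNormedField]
    exact ENat.LEInfty.out
  have hd : DifferentiableAt ℝ (maurerCartanForm τ w) x :=
    ((contDiffOn_maurerCartanForm τ hs hw).contDiffAt hsx).differentiableAt (by simp)
  have key : ∀ a b : V, fderiv ℝ (fun y ↦ τ (star (w y) * fderiv ℝ w y a)) x b =
      τ (star (fderiv ℝ w x b) * fderiv ℝ w x a + star (w x) * fderiv ℝ (fderiv ℝ w) x b a) := by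
    intro a b
    have h1 : HasFDerivAt (fun y ↦ fderiv ℝ w y a) _ x := hw2.clm_apply (hasFDerivAt_const a x)
    have h2 : HasFDerivAt (fun y ↦ τ (star (w y) * fderiv ℝ w y a)) _ x :=
      τ.hasFDerivAt.comp x (hw1.star.mul' h1)
    rw [h2.fderiv]
    simp [add_comm]
  have h2 : star (w x) * w x = 1 := Unitary.star_mul_self_of_mem (hu x hx)
  have h3 : ∀ a, star (fderiv ℝ w x a) = -(star (w x) * fderiv ℝ w x a * star (w x)) := by
    intro a
    have h1 := hw1.star_mul_add_eq_zero (Filter.eventually_of_mem hsx hu) a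
    rw [← neg_mul, ← eq_neg_of_add_eq_zero_left h1, mul_assoc,
      Unitary.mul_star_self_of_mem (hu x hx), mul_one]
  rw [extDeriv_apply hd, Fin.sum_univ_two]
  simp only [maurerCartanForm_apply, Fin.removeNth]
  simp only [key, Fin.coe_ofNat_eq_mod, Nat.zero_mod, Nat.mod_succ, pow_zero, one_smul, pow_one,
    neg_smul, ← map_neg, ← map_add]
  congr 1
  change star (fderiv ℝ w x (v 0)) * fderiv ℝ w x (v 1) +
    star (w x) * fderiv ℝ (fderiv ℝ w) x (v 0) (v 1) + -(star (fderiv ℝ w x (v 1)) *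
      fderiv ℝ w x (v 0) + star (w x) * fderiv ℝ (fderiv ℝ w) x (v 1) (v 0)) = _
  rw [hsymm (v 0) (v 1), h3, h3]
  simp only [mul_sub, sub_mul, mul_assoc, h2, mul_one]
  noncomm_ring

end UnitaryValued

/-! ### Differentials of charts and immersions -/

section Immersions

variable {F E M : Type*} [NormedAddCommGroup F] [NormedSpace ℝ F] [NormedAddCommGroup E]
  [NormedSpace ℝ E] [TopologicalSpace M] [ChartedSpace F M]

theorem contDiffOn_comp_extChartAt_symm [IsManifold 𝓘(ℝ, F) ∞ M] {f : M → E}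
    (hf : ContMDiff 𝓘(ℝ, F) 𝓘(ℝ, E) ∞ f) (x : M) :
    ContDiffOn ℝ ∞ (f ∘ (extChartAt 𝓘(ℝ, F) x).symm) (extChartAt 𝓘(ℝ, F) x).target :=
  contMDiffOn_iff_contDiffOn.1 (hf.comp_contMDiffOn (contMDiffOn_extChartAt_symm x))

theorem fderiv_comp_extChartAt_symm [IsManifold 𝓘(ℝ, F) ∞ M] {f : M → E}
    (hf : ContMDiff 𝓘(ℝ, F) 𝓘(ℝ, E) ∞ f) (x : M) {y : F}
    (hy : y ∈ (extChartAt 𝓘(ℝ, F) x).target) (v : F) :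
    fderiv ℝ (f ∘ (extChartAt 𝓘(ℝ, F) x).symm) y v =
      mfderiv 𝓘(ℝ, F) 𝓘(ℝ, E) f ((extChartAt 𝓘(ℝ, F) x).symm y)
        (mfderiv 𝓘(ℝ, F) 𝓘(ℝ, F) (extChartAt 𝓘(ℝ, F) x).symm y v) := by
  have h1 : MDifferentiableAt 𝓘(ℝ, F) 𝓘(ℝ, F) (extChartAt 𝓘(ℝ, F) x).symm y :=
    ((contMDiffOn_extChartAt_symm (n := ∞) x).contMDiffAt
      ((isOpen_extChartAt_target x).mem_nhds hy)).mdifferentiableAt (by simp)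
  rw [← mfderiv_eq_fderiv]
  exact mfderiv_comp_apply y ((hf _).mdifferentiableAt (by simp)) h1 v

theorem mfderiv_extChartAt_symm_surjective [IsManifold 𝓘(ℝ, F) ∞ M] (x : M) {y : F}
    (hy : y ∈ (extChartAt 𝓘(ℝ, F) x).target) :
    Function.Surjective (mfderiv 𝓘(ℝ, F) 𝓘(ℝ, F) (extChartAt 𝓘(ℝ, F) x).symm y) := by
  have : IsManifold 𝓘(ℝ, F) 1 M := .of_le (n := ∞) (by simp)
  have h := isInvertible_mfderivWithin_extChartAt_symm (I := 𝓘(ℝ, F)) hy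
  rw [ModelWithCorners.range_eq_univ, mfderivWithin_univ] at h
  exact h.bijective.surjective

/-- Differentiate ψ ∘ f = j ∘ φ in immersion charts φ, ψ: both the linear inclusion j and dφ are
injective. -/
theorem Manifold.IsImmersionAt.injective_mfderiv [IsManifold 𝓘(ℝ, F) ∞ M] {f : M → E} {x : M}
    (h : Manifold.IsImmersionAt 𝓘(ℝ, F) 𝓘(ℝ, E) ∞ f x) :
    Function.Injective (mfderiv 𝓘(ℝ, F) 𝓘(ℝ, E) f x) := by
  have hφ : h.domChart.MDifferentiable 𝓘(ℝ, F) 𝓘(ℝ, F) :=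
    ⟨(contMDiffOn_of_mem_maximalAtlas h.domChart_mem_maximalAtlas).mdifferentiableOn (by simp),
      (contMDiffOn_symm_of_mem_maximalAtlas h.domChart_mem_maximalAtlas).mdifferentiableOn
        (by simp)⟩
  have hψ : MDifferentiableAt 𝓘(ℝ, E) 𝓘(ℝ, E) h.codChart (f x) :=
    (contMDiffAt_of_mem_maximalAtlas h.codChart_mem_maximalAtlas
      h.mem_codChart_source).mdifferentiableAt (by simp)
  have hf : MDifferentiableAt 𝓘(ℝ, F) 𝓘(ℝ, E) f x := h.contMDiffAt.mdifferentiableAt (by simp)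
  let j : F →L[ℝ] E := (h.equiv : _ →L[ℝ] E) ∘L ContinuousLinearMap.inl ℝ F h.complement
  have hj : Function.Injective j := h.equiv.injective.comp (Prod.mk_left_injective 0)
  have heq : h.codChart ∘ f =ᶠ[𝓝 x] j ∘ h.domChart := by
    filter_upwards [h.domChart.open_source.mem_nhds h.mem_domChart_source] with y hy
    have h0 : h.domChart y ∈ (h.domChart.extend 𝓘(ℝ, F)).target := by
      simpa using h.domChart.map_source hy
    have h1 := h.writtenInCharts h0
    have h2 : h.domChart.symm (h.domChart y) = y := h.domChart.left_inv hy
    have h3 : h.codChart (f y) = h.equiv (h.domChart y, 0) := by simpa [h2] using h1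
    exact h3
  have h1 := hψ.hasMFDerivAt.comp x hf.hasMFDerivAt
  have h2 := (j.hasMFDerivAt (x := h.domChart x)).comp x
    (hφ.mdifferentiableAt h.mem_domChart_source).hasMFDerivAt
  have h3 := hasMFDerivAt_unique h1 (h2.congr_of_eventuallyEq heq)
  intro v w hvw
  have h4 := DFunLike.congr_fun h3 v
  have h5 := DFunLike.congr_fun h3 w
  exact hφ.mfderiv_injective h.mem_domChart_source (hj (h4.symm.trans ((congrArg
    (mfderiv 𝓘(ℝ, E) 𝓘(ℝ, E) h.codChart (f x)) hvw).trans h5)))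

/-- The velocity of a smooth curve lying in the image of a smooth embedding is the image of a
tangent vector. -/
theorem Manifold.IsSmoothEmbedding.exists_mfderiv_eq_deriv {E : Type*} [NormedAddCommGroup E]
    [NormedSpace ℝ E] [IsManifold 𝓘(ℝ, F) ∞ M] {f : M → E}
    (hf : Manifold.IsSmoothEmbedding 𝓘(ℝ, F) 𝓘(ℝ, E) ∞ f) {c : ℝ → E} (hc : ContDiff ℝ ∞ c)
    (hrange : ∀ t, c t ∈ range f) {x : M} (hx : c 0 = f x) {v : E} (hv : HasDerivAt c v 0) :
    ∃ X, mfderiv 𝓘(ℝ, F) 𝓘(ℝ, E) f x X = v := by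
  choose γ hγ using hrange
  have hfγ : f ∘ γ = c := funext hγ
  obtain rfl : x = γ 0 := hf.isEmbedding.injective (hx.symm.trans (hγ 0).symm)
  -- The topological embedding makes the lift continuous; the immersion property then makes it
  -- smooth.
  have hγc : ContMDiffAt 𝓘(ℝ, ℝ) 𝓘(ℝ, F) ∞ γ 0 := by
    rw [ContMDiffAt.iff_comp_isImmersionAt (hf.isImmersion.isImmersionAt (γ 0)), hfγ]
    refine ⟨Continuous.continuousAt ?_, hc.contMDiff 0⟩
    rw [hf.isEmbedding.continuous_iff, hfγ]
    exact hc.continuous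
  refine ⟨mfderiv 𝓘(ℝ, ℝ) 𝓘(ℝ, F) γ 0 (1 : ℝ), ?_⟩
  have h1 : mfderiv 𝓘(ℝ, ℝ) 𝓘(ℝ, E) (f ∘ γ) 0 (1 : ℝ) = v := by
    rw [hfγ, mfderiv_eq_fderiv]
    exact hv.deriv
  exact (mfderiv_comp_apply 0 ((hf.contMDiff _).mdifferentiableAt (by simp))
    (hγc.mdifferentiableAt (by simp)) _).symm.trans h1

end Immersions

/-! ### The tangent space of the orbit -/

section TangentSpace

variable {H : Type*} [NormedAddCommGroup H] [InnerProductSpace ℂ H] [CompleteSpace H]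

/-- The Hermitian operator `iħ a` associated with a skew-adjoint operator `a`. -/
noncomputable def iHbarMul (hbar : ℝ) (a : H →L[ℂ] H) (ha : star a = -a) : HermitianOp H :=
  ⟨(Complex.I * hbar) • a, by
    change star _ = _
    rw [star_smul, ha, smul_neg, ← neg_smul]
    congr 1
    simp⟩

theorem coe_iHbarMul (hbar : ℝ) (a : H →L[ℂ] H) (ha : star a = -a) :
    (iHbarMul hbar a ha : H →L[ℂ] H) = (Complex.I * hbar) • a := rfl

theorem divIHbar_iHbarMul {hbar : ℝ} (hh : hbar ≠ 0) (a : H →L[ℂ] H) (ha : star a = -a) :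
    divIHbar hbar (iHbarMul hbar a ha) = a := by
  rw [divIHbar_apply, coe_iHbarMul, smul_smul, one_div_mul_cancel (by simp [hh]), one_smul]

variable {F : Type*} [NormedAddCommGroup F] [NormedSpace ℝ F] {ρ₀ : HermitianOp H}

theorem star_fderiv_mul_star {s : Set F} (hs : IsOpen s) {w : F → H →L[ℂ] H}
    (hw : ContDiffOn ℝ ∞ w s) (hu : ∀ z, w z ∈ unitary (H →L[ℂ] H)) {z : F} (hz : z ∈ s) (v : F) :
    star (fderiv ℝ w z v * star (w z)) = -(fderiv ℝ w z v * star (w z)) := by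
  have h1 : HasFDerivAt w (fderiv ℝ w z) z :=
    ((hw.contDiffAt (hs.mem_nhds hz)).differentiableAt (by simp)).hasFDerivAt
  have h2 := h1.star_mul_add_eq_zero (Eventually.of_forall hu) v
  have h3 : w z * star (w z) = 1 := Unitary.mul_star_self_of_mem (hu z)
  rw [star_mul, star_star]
  calc w z * star (fderiv ℝ w z v)
      = w z * (star (fderiv ℝ w z v) * w z) * star (w z) := by
        rw [mul_assoc, mul_assoc, h3, mul_one]
    _ = -(w z * star (w z) * fderiv ℝ w z v * star (w z)) := by
        rw [eq_neg_of_add_eq_zero_left h2, mul_neg, neg_mul, mul_assoc (w z) (star (w z))]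
    _ = _ := by rw [h3, one_mul]

theorem tangentInclusion_injective [cs : ChartedSpace F (unitaryOrbit ρ₀)]
    (h : IsEmbeddedOrbit ρ₀ cs) (ρ : unitaryOrbit ρ₀) :
    Function.Injective (tangentInclusion F ρ) := by
  have := h.1
  exact (h.2.isImmersion.isImmersionAt ρ).injective_mfderiv

/-- From c = wρ₀w† comes Dc = [a, c] with a = (Dw)w†, and [a, c] = (1/iħ)[iħa, c]. -/
theorem fderiv_eq_tangentOp {hbar : ℝ} (hh : hbar ≠ 0) {s : Set F} (hs : IsOpen s)
    {w : F → H →L[ℂ] H} (hw : ContDiffOn ℝ ∞ w s) (hu : ∀ z, w z ∈ unitary (H →L[ℂ] H))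
    {c : F → HermitianOp H} (hc : ContDiffOn ℝ ∞ c s) (hcw : ∀ z ∈ s, c z = conjOp (w z) ρ₀)
    {z : F} (hz : z ∈ s) (v : F) :
    fderiv ℝ c z v = tangentOp hbar (iHbarMul hbar (fderiv ℝ w z v * star (w z))
      (star_fderiv_mul_star hs hw hu hz v)) (c z) := by
  have hsz : s ∈ 𝓝 z := hs.mem_nhds hz
  have h1 : HasFDerivAt w (fderiv ℝ w z) z :=
    ((hw.contDiffAt hsz).differentiableAt (by simp)).hasFDerivAt
  let f' : F →L[ℝ] (H →L[ℂ] H) := (HermitianOp H).subtypeL ∘L fderiv ℝ c z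
  have h2 : HasFDerivAt (fun y ↦ (c y : H →L[ℂ] H)) f' z :=
    (HermitianOp H).subtypeL.hasFDerivAt.comp z
      ((hc.contDiffAt hsz).differentiableAt (by simp)).hasFDerivAt
  let r : H →L[ℂ] H := ρ₀
  let L : (H →L[ℂ] H) →L[ℝ] (H →L[ℂ] H) :=
    (ContinuousLinearMap.mul ℝ (H →L[ℂ] H)).flip (star (w z) * (w z * r * star (w z))) -
      (ContinuousLinearMap.mul ℝ (H →L[ℂ] H)) (w z * r * star (w z)) ∘L
        (ContinuousLinearMap.mul ℝ (H →L[ℂ] H)).flip (star (w z))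
  have h3 : HasFDerivAt (fun y ↦ w y * r * star (w y)) (L ∘L fderiv ℝ w z) z := by
    refine h1.unitary_conj (Eventually.of_forall hu) fun v ↦ ?_
    simp [L, mul_assoc]
  have h4 := h2.unique (h3.congr_of_eventuallyEq
    (eventually_of_mem hsz fun y hy ↦ congrArg Subtype.val (hcw y hy)))
  have h5 : ((fderiv ℝ c z v : HermitianOp H) : H →L[ℂ] H) = L (fderiv ℝ w z v) :=
    DFunLike.congr_fun h4 v
  refine Subtype.ext (h5.trans ?_)
  rw [coe_tangentOp, divIHbar_iHbarMul hh, hcw z hz, coe_conjOp]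
  simp [L, r, mul_assoc]

variable [FiniteDimensional ℂ H] [cs : ChartedSpace F (unitaryOrbit ρ₀)]

/-- Near each point of a chart domain, an embedded orbit is parametrized by unitary operators
depending smoothly on the coordinates. -/
theorem exists_unitary_lift (h : IsEmbeddedOrbit ρ₀ cs) (x : unitaryOrbit ρ₀) {y : F}
    (hy : y ∈ (extChartAt 𝓘(ℝ, F) x).target) :
    ∃ s ⊆ (extChartAt 𝓘(ℝ, F) x).target, IsOpen s ∧ y ∈ s ∧ ∃ w : F → H →L[ℂ] H,
      ContDiffOn ℝ ∞ w s ∧ (∀ z, w z ∈ unitary (H →L[ℂ] H)) ∧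
      ContDiffOn ℝ ∞ (Subtype.val ∘ (extChartAt 𝓘(ℝ, F) x).symm) s ∧
      ∀ z ∈ s, (Subtype.val ∘ (extChartAt 𝓘(ℝ, F) x).symm) z = conjOp (w z) ρ₀ := by
  have := h.1
  obtain ⟨O, W, hO, hyO, hW, hWu, hWO⟩ :=
    exists_local_section_unitaryOrbit ((extChartAt 𝓘(ℝ, F) x).symm y).2
  have hc := contDiffOn_comp_extChartAt_symm h.2.contMDiff x
  refine ⟨_, inter_subset_left, hc.continuousOn.isOpen_inter_preimage
    (isOpen_extChartAt_target x) hO, ⟨hy, hyO⟩,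
    W ∘ (Subtype.val ∘ (extChartAt 𝓘(ℝ, F) x).symm), ?_, fun z ↦ hWu _, ?_, ?_⟩
  · exact hW.comp (hc.mono inter_subset_left) fun z hz ↦ hz.2
  · exact hc.mono inter_subset_left
  · exact fun z hz ↦ hWO _ hz.2 (Subtype.coe_prop _)

theorem hasDerivAt_conjExp_line (hbar : ℝ) (A ρ : HermitianOp H) :
    HasDerivAt (fun t : ℝ ↦ conjExp hbar ρ (t • A, 0)) (tangentOp hbar A ρ) 0 := by
  let l : ℝ →L[ℝ] HermitianOp H × HermitianOp H :=
    (ContinuousLinearMap.id ℝ ℝ).smulRight (A, (0 : HermitianOp H))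
  have h1 := hasFDerivAt_conjExp hbar ρ
  rw [← map_zero l] at h1
  have h2 := (h1.comp 0 l.hasFDerivAt).hasDerivAt
  have h3 : (fun t : ℝ ↦ conjExp hbar ρ (t • A, 0)) = conjExp hbar ρ ∘ l := by
    funext t
    simp [l]
  rw [h3]
  convert! h2
  simp [l]

/-- One inclusion differentiates a local unitary lift; the other lifts the curve t ↦ exp(tA/iħ)ρ
exp(tA/iħ)† to the orbit. -/
theorem range_tangentInclusion {hbar : ℝ} (hh : hbar ≠ 0) (h : IsEmbeddedOrbit ρ₀ cs)
    (ρ : unitaryOrbit ρ₀) : range (tangentInclusion F ρ) =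
      range (fun A : HermitianOp H ↦ tangentOp hbar A (ρ : HermitianOp H)) := by
  have := h.1
  refine Subset.antisymm ?_ ?_
  · rintro _ ⟨X, rfl⟩
    obtain ⟨s, hst, hs, hys, w, hw, hu, hc, hcw⟩ := exists_unitary_lift h ρ
      (mem_extChartAt_target (I := 𝓘(ℝ, F)) ρ)
    have h0 := extChartAt_to_inv (I := 𝓘(ℝ, F)) ρ
    have h1 := fderiv_comp_extChartAt_symm h.2.contMDiff ρ (hst hys)
    have h2 := mfderiv_extChartAt_symm_surjective ρ (hst hys)
    rw [h0] at h1 h2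
    obtain ⟨v, hv⟩ := h2 X
    have h3 : fderiv ℝ (Subtype.val ∘ (extChartAt 𝓘(ℝ, F) ρ).symm) (extChartAt 𝓘(ℝ, F) ρ ρ) v =
        tangentInclusion F ρ X := by
      rw [← hv]
      exact h1 v
    have h4 := fderiv_eq_tangentOp hh hs hw hu hc hcw hys v
    rw [Function.comp_apply, h0] at h4
    exact ⟨_, h4.symm.trans h3⟩
  · rintro _ ⟨A, rfl⟩
    refine h.2.exists_mfderiv_eq_deriv (c := fun t ↦ conjExp hbar ρ (t • A, 0)) ?_ ?_ ?_
      (hasDerivAt_conjExp_line hbar A ρ)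
    · exact (contDiff_conjExp hbar _).comp
        (f := fun t : ℝ ↦ (t • A, (0 : HermitianOp H))) (by fun_prop)
    · intro t
      rw [Subtype.range_coe, conjExp, conjOp_mem_unitaryOrbit (expHermitian_mem_unitary _ _),
        add_zero]
      exact ρ.2
    · rw [zero_smul]
      exact Subtype.ext (by simp [conjExp])

end TangentSpace

/-! ### Existence, uniqueness and non-degeneracy of the form -/

theorem exists_continuousAlternatingMap_of_bilinear {V : Type*} [NormedAddCommGroup V]
    [NormedSpace ℝ V] [FiniteDimensional ℝ V] (B : V →ₗ[ℝ] V →ₗ[ℝ] ℝ)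
    (hB : ∀ X Y, B Y X = -B X Y) : ∃ Ω : V [⋀^Fin 2]→L[ℝ] ℝ, ∀ X Y, Ω ![X, Y] = B X Y := by
  let g : V →L[ℝ] V →L[ℝ] ℝ :=
    (LinearMap.toContinuousLinearMap.toLinearMap ∘ₗ B).toContinuousLinearMap
  let e := ContinuousAlternatingMap.ofSubsingletonLIE (𝕜 := ℝ) (E := V) (F := ℝ) (0 : Fin 1)
  let f : V →L[ℝ] V [⋀^Fin 1]→L[ℝ] ℝ :=
    (e.toContinuousLinearEquiv : _ →L[ℝ] V [⋀^Fin 1]→L[ℝ] ℝ) ∘L g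
  have hf : ∀ X v, f X v = B X (v 0) := fun X v ↦ rfl
  -- Alternatization yields B(X, Y) − B(Y, X) = 2B(X, Y), hence the factor 1/2.
  refine ⟨(1 / 2 : ℝ) • ContinuousAlternatingMap.alternatizeUncurryFin f, fun X Y ↦ ?_⟩
  rw [ContinuousAlternatingMap.smul_apply, ContinuousAlternatingMap.alternatizeUncurryFin_apply,
    Fin.sum_univ_two]
  simp only [hf, Fin.removeNth]
  simp [hB X Y]
  ring

theorem LinearMap.exists_lift_of_mem_range {V W : Type*} [AddCommGroup V] [Module ℝ V]
    [AddCommGroup W] [Module ℝ W] (L : W →ₗ[ℝ] W) (J : V →ₗ[ℝ] W) (hJ : ∀ X, ∃ A, L A = J X) :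
    ∃ σ : V →ₗ[ℝ] W, ∀ X, L (σ X) = J X := by
  obtain ⟨g, hg⟩ := L.rangeRestrict.exists_rightInverse_of_surjective L.range_rangeRestrict
  exact ⟨g ∘ₗ J.codRestrict L.range hJ, fun X ↦
    congrArg Subtype.val (LinearMap.congr_fun hg (J.codRestrict L.range hJ X))⟩

section KKS

variable {H : Type*} [NormedAddCommGroup H] [InnerProductSpace ℂ H] [CompleteSpace H]

theorem opTrace_mul_tangentOp (hbar : ℝ) (A B ρ : HermitianOp H) :
    opTrace ((A : H →L[ℂ] H) * (tangentOp hbar B ρ : H →L[ℂ] H)) = 1 / (Complex.I * hbar) *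
      opTrace (opCommutator (A : H →L[ℂ] H) (B : H →L[ℂ] H) * (ρ : H →L[ℂ] H)) := by
  simp only [tangentOp, opCommutator, mul_smul_comm, opTrace_smul, mul_sub, sub_mul, opTrace_sub]
  rw [← mul_assoc, ← mul_assoc, mul_assoc (B : H →L[ℂ] H), opTrace_mul_comm (B : H →L[ℂ] H)]

/-- The real bilinear form `(A, B) ↦ (1 / iħ) Tr ([A, B] ρ)`. -/
noncomputable def traceForm (hbar : ℝ) (ρ : HermitianOp H) :
    HermitianOp H →ₗ[ℝ] HermitianOp H →ₗ[ℝ] ℝ :=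
  LinearMap.mk₂ ℝ
    -- In the shape Tr(A·TB) the value visibly depends on B only through TB; the trace is already
    -- real.
    (fun A B ↦ (opTrace ((A : H →L[ℂ] H) * (tangentOp hbar B ρ : H →L[ℂ] H))).re)
    (fun A A' B ↦ by rw [Submodule.coe_add, add_mul, opTrace_add, Complex.add_re])
    (fun c A B ↦ by
      rw [Submodule.coe_smul, smul_mul_assoc, ← Complex.coe_smul, opTrace_smul,
        Complex.re_ofReal_mul, smul_eq_mul])
    (fun A B B' ↦ by
      rw [← tangentOpL_apply, map_add, Submodule.coe_add, mul_add, opTrace_add, Complex.add_re]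
      rfl)
    (fun c A B ↦ by
      rw [← tangentOpL_apply, map_smul, Submodule.coe_smul, mul_smul_comm, ← Complex.coe_smul,
        opTrace_smul, Complex.re_ofReal_mul, smul_eq_mul]
      rfl)

theorem traceForm_apply (hbar : ℝ) (ρ A B : HermitianOp H) :
    traceForm hbar ρ A B =
      (opTrace ((A : H →L[ℂ] H) * (tangentOp hbar B ρ : H →L[ℂ] H))).re := rfl

theorem traceForm_swap (hbar : ℝ) (ρ A B : HermitianOp H) :
    traceForm hbar ρ B A = -traceForm hbar ρ A B := by
  rw [traceForm_apply, opTrace_mul_comm, opTrace_tangentOp_mul, Complex.neg_re, traceForm_apply]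

/-- Well-definedness on tangent vectors: dependence through TB is clear, and skewness transfers it
to A. -/
theorem traceForm_congr {hbar : ℝ} {ρ A A' B B' : HermitianOp H}
    (hA : tangentOp hbar A ρ = tangentOp hbar A' ρ)
    (hB : tangentOp hbar B ρ = tangentOp hbar B' ρ) :
    traceForm hbar ρ A B = traceForm hbar ρ A' B' := by
  rw [traceForm_apply, hB, ← traceForm_apply, traceForm_swap, traceForm_apply, hA,
    ← traceForm_apply, ← traceForm_swap]

/-- A linear choice σ of preimages under T makes the pulled-back form bilinear; its values do not
depend on σ. -/
theorem exists_continuousAlternatingMap_traceForm {V : Type*} [NormedAddCommGroup V]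
    [NormedSpace ℝ V] [FiniteDimensional ℝ V] (hbar : ℝ) (ρ : HermitianOp H)
    (J : V →L[ℝ] HermitianOp H) (hJ : ∀ X, ∃ A, tangentOp hbar A ρ = J X) :
    ∃ Ω : V [⋀^Fin 2]→L[ℝ] ℝ, ∀ X Y A B, J X = tangentOp hbar A ρ → J Y = tangentOp hbar B ρ →
      Ω ![X, Y] = traceForm hbar ρ A B := by
  obtain ⟨σ, hσ⟩ := (tangentOpL hbar ρ).exists_lift_of_mem_range (J : V →ₗ[ℝ] HermitianOp H) hJ
  obtain ⟨Ω, hΩ⟩ := exists_continuousAlternatingMap_of_bilinear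
    ((traceForm hbar ρ).compl₁₂ σ σ) fun X Y ↦ traceForm_swap hbar ρ (σ X) (σ Y)
  refine ⟨Ω, fun X Y A B hX hY ↦ ?_⟩
  rw [hΩ]
  exact traceForm_congr ((hσ X).trans hX) ((hσ Y).trans hY)

variable [FiniteDimensional ℂ H]

theorem coe_traceForm (hbar : ℝ) (ρ A B : HermitianOp H) :
    ((traceForm hbar ρ A B : ℝ) : ℂ) = 1 / (Complex.I * hbar) *
      opTrace (opCommutator (A : H →L[ℂ] H) (B : H →L[ℂ] H) * (ρ : H →L[ℂ] H)) := by
  rw [← opTrace_mul_tangentOp, traceForm_apply]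
  exact Complex.ext rfl (opTrace_mul_im_eq_zero A (tangentOp hbar B ρ)).symm

/-- Test against B = TA, which gives −Tr((TA)²). -/
theorem tangentOp_eq_zero_of_traceForm_eq_zero {hbar : ℝ} {ρ A : HermitianOp H}
    (h : ∀ B, traceForm hbar ρ A B = 0) : tangentOp hbar A ρ = 0 := by
  refine Subtype.ext (eq_zero_of_opTrace_mul_self (tangentOp hbar A ρ).2 ?_)
  rw [opTrace_tangentOp_mul, neg_eq_zero]
  exact Complex.ext (h (tangentOp hbar A ρ)) (opTrace_mul_im_eq_zero A _)

variable {F : Type*} [NormedAddCommGroup F] [NormedSpace ℝ F] {ρ₀ : HermitianOp H}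
  [cs : ChartedSpace F (unitaryOrbit ρ₀)] {hbar : ℝ}
  {Ω : (ρ : unitaryOrbit ρ₀) → TangentSpace 𝓘(ℝ, F) ρ [⋀^Fin 2]→L[ℝ] ℝ}

theorem isKKSForm_iff : IsKKSForm hbar Ω ↔ ∀ (ρ : unitaryOrbit ρ₀) (A B : HermitianOp H)
    (X Y : TangentSpace 𝓘(ℝ, F) ρ), tangentInclusion F ρ X = tangentOp hbar A ρ →
      tangentInclusion F ρ Y = tangentOp hbar B ρ →
        Ω ρ ![X, Y] = traceForm hbar (ρ : HermitianOp H) A B := by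
  simp only [IsKKSForm, ← coe_traceForm, Complex.ofReal_inj]

theorem exists_tangentOp_eq_tangentInclusion (hh : hbar ≠ 0) (h : IsEmbeddedOrbit ρ₀ cs)
    (ρ : unitaryOrbit ρ₀) (X : TangentSpace 𝓘(ℝ, F) ρ) :
    ∃ A, tangentOp hbar A (ρ : HermitianOp H) = tangentInclusion F ρ X :=
  (range_tangentInclusion hh h ρ).subset (mem_range_self X)

theorem exists_isKKSForm [FiniteDimensional ℝ F] (hh : hbar ≠ 0) (h : IsEmbeddedOrbit ρ₀ cs) :
    ∃ Ω : (ρ : unitaryOrbit ρ₀) → TangentSpace 𝓘(ℝ, F) ρ [⋀^Fin 2]→L[ℝ] ℝ,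
      IsKKSForm hbar Ω := by
  have hΩ (ρ : unitaryOrbit ρ₀) := exists_continuousAlternatingMap_traceForm (V := F) hbar
    (ρ : HermitianOp H) (tangentInclusion F ρ) (exists_tangentOp_eq_tangentInclusion hh h ρ)
  let Ω : (ρ : unitaryOrbit ρ₀) → TangentSpace 𝓘(ℝ, F) ρ [⋀^Fin 2]→L[ℝ] ℝ := fun ρ ↦ (hΩ ρ).choose
  have hΩ' : ∀ (ρ : unitaryOrbit ρ₀) (A B : HermitianOp H) (X Y : TangentSpace 𝓘(ℝ, F) ρ),
      tangentInclusion F ρ X = tangentOp hbar A ρ → tangentInclusion F ρ Y = tangentOp hbar B ρ →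
        Ω ρ ![X, Y] = traceForm hbar (ρ : HermitianOp H) A B :=
    fun ρ A B X Y ↦ (hΩ ρ).choose_spec X Y A B
  exact ⟨Ω, isKKSForm_iff.2 hΩ'⟩

theorem IsKKSForm.unique (hh : hbar ≠ 0) (h : IsEmbeddedOrbit ρ₀ cs) (hΩ : IsKKSForm hbar Ω)
    {Ω' : (ρ : unitaryOrbit ρ₀) → TangentSpace 𝓘(ℝ, F) ρ [⋀^Fin 2]→L[ℝ] ℝ}
    (hΩ' : IsKKSForm hbar Ω') : Ω = Ω' := by
  funext ρ
  refine ContinuousAlternatingMap.ext fun v ↦ ?_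
  obtain ⟨A, hA⟩ := exists_tangentOp_eq_tangentInclusion hh h ρ (v 0)
  obtain ⟨B, hB⟩ := exists_tangentOp_eq_tangentInclusion hh h ρ (v 1)
  have hv : v = ![v 0, v 1] := funext fun i ↦ by fin_cases i <;> rfl
  rw [hv]
  exact (isKKSForm_iff.1 hΩ ρ A B _ _ hA.symm hB.symm).trans
    (isKKSForm_iff.1 hΩ' ρ A B _ _ hA.symm hB.symm).symm

theorem IsKKSForm.nondegenerate (hΩ : IsKKSForm hbar Ω) (hh : hbar ≠ 0)
    (h : IsEmbeddedOrbit ρ₀ cs) (ρ : unitaryOrbit ρ₀) (X : TangentSpace 𝓘(ℝ, F) ρ)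
    (hX : ∀ Y : TangentSpace 𝓘(ℝ, F) ρ, Ω ρ ![X, Y] = 0) : X = 0 := by
  obtain ⟨A, hA⟩ := (range_tangentInclusion hh h ρ).subset (mem_range_self X)
  have hA' : tangentInclusion F ρ X = tangentOp hbar A ρ := hA.symm
  apply tangentInclusion_injective h ρ
  rw [map_zero, hA']
  refine tangentOp_eq_zero_of_traceForm_eq_zero fun B ↦ ?_
  obtain ⟨Y, hY⟩ := (range_tangentInclusion hh h ρ).superset (mem_range_self B)
  rw [← isKKSForm_iff.1 hΩ ρ A B X Y hA' hY, hX]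

end KKS

theorem ContDiffOn.extDeriv_of_isOpen {V : Type*} [NormedAddCommGroup V] [NormedSpace ℝ V] {k : ℕ}
    {η : V → V [⋀^Fin k]→L[ℝ] ℝ} {s : Set V} (hs : IsOpen s) (hη : ContDiffOn ℝ ∞ η s) :
    ContDiffOn ℝ ∞ (extDeriv η) s :=
  (ContinuousAlternatingMap.alternatizeUncurryFinCLM ℝ V ℝ).contDiff.comp_contDiffOn
    (hη.fderiv_of_isOpen hs (by simp))

/-! ### Local exactness, smoothness and closedness -/

section Closed

variable {H : Type*} [NormedAddCommGroup H] [InnerProductSpace ℂ H] [CompleteSpace H]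
  [FiniteDimensional ℂ H]

/-- The real linear functional `b ↦ Re (-iħ Tr (r b))`. -/
noncomputable def momentFunctional (hbar : ℝ) (r : H →L[ℂ] H) : (H →L[ℂ] H) →L[ℝ] ℝ :=
  let T : (H →L[ℂ] H) →ₗ[ℂ] ℂ :=
    { toFun := fun b ↦ -(Complex.I * hbar) * opTrace (r * b)
      map_add' := fun a b ↦ by rw [mul_add, opTrace_add, mul_add]
      map_smul' := fun c a ↦ by
        rw [mul_smul_comm, opTrace_smul, RingHom.id_apply, smul_eq_mul, mul_left_comm] }
  Complex.reCLM ∘L T.toContinuousLinearMap.restrictScalars ℝ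

omit [CompleteSpace H] in
theorem momentFunctional_apply (hbar : ℝ) (r b : H →L[ℂ] H) :
    momentFunctional hbar r b = (-(Complex.I * hbar) * opTrace (r * b)).re := rfl

/-- Two factors iħ against one 1/iħ leave iħ, and cyclicity moves w onto the commutator. This
matches the right-hand side of the Maurer–Cartan equation. -/
theorem traceForm_iHbarMul {hbar : ℝ} (hh : hbar ≠ 0) {w : H →L[ℂ] H}
    (ρ₀ : HermitianOp H) {a b : H →L[ℂ] H} (ha : star a = -a) (hb : star b = -b) :
    traceForm hbar (conjOp w ρ₀) (iHbarMul hbar a ha) (iHbarMul hbar b hb) =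
      -momentFunctional hbar (ρ₀ : H →L[ℂ] H) (star w * (a * b - b * a) * w) := by
  rw [momentFunctional_apply, ← Complex.neg_re, ← Complex.ofReal_re (traceForm _ _ _ _),
    coe_traceForm, coe_conjOp, coe_iHbarMul, coe_iHbarMul]
  congr 1
  have h1 : opCommutator ((Complex.I * hbar) • a) ((Complex.I * hbar) • b) =
      (Complex.I * hbar) • (Complex.I * hbar) • (a * b - b * a) := by
    simp only [opCommutator, smul_mul_assoc, mul_smul_comm, smul_sub]
  have h2 : opTrace ((a * b - b * a) * (w * (ρ₀ : H →L[ℂ] H) * star w)) =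
      opTrace ((ρ₀ : H →L[ℂ] H) * (star w * (a * b - b * a) * w)) := by
    generalize a * b - b * a = c
    rw [opTrace_mul_comm, mul_assoc w, mul_assoc w, opTrace_mul_comm w]
    simp only [mul_assoc]
  have h3 : Complex.I * (hbar : ℂ) ≠ 0 := by simp [hh]
  rw [h1, smul_mul_assoc, smul_mul_assoc, opTrace_smul, opTrace_smul, h2]
  field_simp

variable {F : Type*} [NormedAddCommGroup F] [NormedSpace ℝ F] {ρ₀ : HermitianOp H}
  [cs : ChartedSpace F (unitaryOrbit ρ₀)] {hbar : ℝ}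
  {Ω : (ρ : unitaryOrbit ρ₀) → TangentSpace 𝓘(ℝ, F) ρ [⋀^Fin 2]→L[ℝ] ℝ}

/-- In a chart, the Kirillov-Kostant-Souriau form is locally exact. -/
theorem IsKKSForm.exists_formInChart_eq_extDeriv (hΩ : IsKKSForm hbar Ω) (hh : hbar ≠ 0)
    (h : IsEmbeddedOrbit ρ₀ cs) (x : unitaryOrbit ρ₀) {y : F}
    (hy : y ∈ (extChartAt 𝓘(ℝ, F) x).target) : ∃ s : Set F, IsOpen s ∧ y ∈ s ∧
      ∃ θ : F → F [⋀^Fin 1]→L[ℝ] ℝ, ContDiffOn ℝ ∞ θ s ∧ EqOn (formInChart Ω x) (extDeriv θ) s := by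
  obtain ⟨s, hst, hs, hys, w, hw, hu, hc, hcw⟩ := exists_unitary_lift h x hy
  refine ⟨s, hs, hys, maurerCartanForm (momentFunctional hbar (ρ₀ : H →L[ℂ] H)) w,
    contDiffOn_maurerCartanForm _ hs hw, fun z hz ↦ ContinuousAlternatingMap.ext fun v ↦ ?_⟩
  rw [extDeriv_maurerCartanForm _ hs hw (fun z _ ↦ hu z) hz, ← traceForm_iHbarMul hh ρ₀
    (star_fderiv_mul_star hs hw hu hz (v 0)) (star_fderiv_mul_star hs hw hu hz (v 1)), ← hcw z hz]
  have := h.1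
  have h1 := fderiv_comp_extChartAt_symm h.2.contMDiff x (hst hz)
  have h2 : formInChart Ω x z v = Ω ((extChartAt 𝓘(ℝ, F) x).symm z)
      ![mfderiv 𝓘(ℝ, F) 𝓘(ℝ, F) (extChartAt 𝓘(ℝ, F) x).symm z (v 0),
        mfderiv 𝓘(ℝ, F) 𝓘(ℝ, F) (extChartAt 𝓘(ℝ, F) x).symm z (v 1)] := by
    refine congrArg (Ω ((extChartAt 𝓘(ℝ, F) x).symm z)) (funext fun i ↦ ?_)
    fin_cases i <;> rfl
  refine h2.trans (isKKSForm_iff.1 hΩ _ _ _ _ _ ?_ ?_)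
  · exact (h1 (v 0)).symm.trans (fderiv_eq_tangentOp hh hs hw hu hc hcw hz (v 0))
  · exact (h1 (v 1)).symm.trans (fderiv_eq_tangentOp hh hs hw hu hc hcw hz (v 1))

theorem IsKKSForm.isSmoothForm (hΩ : IsKKSForm hbar Ω) (hh : hbar ≠ 0)
    (h : IsEmbeddedOrbit ρ₀ cs) : IsSmoothForm Ω := by
  intro x y hy
  obtain ⟨s, hs, hys, θ, hθ, heq⟩ := hΩ.exists_formInChart_eq_extDeriv hh h x hy
  exact (((hθ.extDeriv_of_isOpen hs).congr heq).contDiffAt (hs.mem_nhds hys)).contDiffWithinAt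

/-- Near the base point the chart expression is dθ, and d² = 0. -/
theorem IsKKSForm.extDerivManifold_eq_zero (hΩ : IsKKSForm hbar Ω) (hh : hbar ≠ 0)
    (h : IsEmbeddedOrbit ρ₀ cs) (x : unitaryOrbit ρ₀) : extDerivManifold Ω x = 0 := by
  obtain ⟨s, hs, hys, θ, hθ, heq⟩ :=
    hΩ.exists_formInChart_eq_extDeriv hh h x (mem_extChartAt_target (I := 𝓘(ℝ, F)) x)
  have hsx : s ∈ 𝓝 (extChartAt 𝓘(ℝ, F) x x) := hs.mem_nhds hys
  have h1 : extDeriv (formInChart Ω x) (extChartAt 𝓘(ℝ, F) x x) = 0 := by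
    rw [(heq.eventuallyEq_of_mem hsx).extDeriv_eq]
    refine extDeriv_extDeriv_apply (hθ.contDiffAt hsx) ?_
    rw [minSmoothness_of_isRCLikeNormedField]
    exact ENat.LEInfty.out
  exact congrArg (fun η : F [⋀^Fin 3]→L[ℝ] ℝ ↦ η.compContinuousLinearMap
    (mfderiv 𝓘(ℝ, F) 𝓘(ℝ, F) (extChartAt 𝓘(ℝ, F) x) x : F →L[ℝ] F)) h1

theorem IsKKSForm.isSymplecticForm (hΩ : IsKKSForm hbar Ω) (hh : hbar ≠ 0)
    (h : IsEmbeddedOrbit ρ₀ cs) : IsSymplecticForm Ω :=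
  ⟨hΩ.isSmoothForm hh h, hΩ.nondegenerate hh h, hΩ.extDerivManifold_eq_zero hh h⟩

end Closed

theorem mainTheorem3 {H : Type*} [NormedAddCommGroup H] [InnerProductSpace ℂ H]
    [FiniteDimensional ℂ H] [CompleteSpace H] (hbar : ℝ) (hhbar : 0 < hbar)
    (ρ₀ : HermitianOp H) (hρ₀ : IsDensityOperator ρ₀) :
    -- the orbit consists of all density operators with the spectrum of `ρ₀`
    (∀ ρ : HermitianOp H, ρ ∈ unitaryOrbit ρ₀ ↔
      IsDensityOperator ρ ∧
        ((ρ : H →L[ℂ] H) : H →ₗ[ℂ] H).charpoly = ((ρ₀ : H →L[ℂ] H) : H →ₗ[ℂ] H).charpoly) ∧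
    -- the orbit is a smooth embedded submanifold of the space of Hermitian operators
    (∃ (d : ℕ) (cs : ChartedSpace (EuclideanSpace ℝ (Fin d)) (unitaryOrbit ρ₀)),
      IsEmbeddedOrbit ρ₀ cs) ∧
    ∀ (d : ℕ) (cs : ChartedSpace (EuclideanSpace ℝ (Fin d)) (unitaryOrbit ρ₀)),
      IsEmbeddedOrbit ρ₀ cs →
      -- its tangent space at `ρ` consists of the operators `(1 / iħ) [A, ρ]`
      (∀ ρ : unitaryOrbit ρ₀, Function.Injective (tangentInclusion (EuclideanSpace ℝ (Fin d)) ρ) ∧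
        Set.range (tangentInclusion (EuclideanSpace ℝ (Fin d)) ρ) =
          Set.range (fun A : HermitianOp H ↦ tangentOp hbar A (ρ : HermitianOp H))) ∧
      -- the form exists, is unique, and is symplectic
      (∃! Ω : (ρ : unitaryOrbit ρ₀) →
          TangentSpace 𝓘(ℝ, EuclideanSpace ℝ (Fin d)) ρ [⋀^Fin 2]→L[ℝ] ℝ, IsKKSForm hbar Ω) ∧
      ∀ Ω : (ρ : unitaryOrbit ρ₀) →
          TangentSpace 𝓘(ℝ, EuclideanSpace ℝ (Fin d)) ρ [⋀^Fin 2]→L[ℝ] ℝ,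
        IsKKSForm hbar Ω → IsSymplecticForm Ω := by
  refine ⟨mem_unitaryOrbit_iff hρ₀, exists_isEmbeddedOrbit ρ₀, fun d cs h ↦
    ⟨fun ρ ↦ ⟨tangentInclusion_injective h ρ, range_tangentInclusion hhbar.ne' h ρ⟩, ?_,
      fun Ω hΩ ↦ hΩ.isSymplecticForm hhbar.ne' h⟩⟩
  obtain ⟨Ω, hΩ⟩ := exists_isKKSForm hhbar.ne' h
  exact ⟨Ω, hΩ, fun Ω' hΩ' ↦ hΩ'.unique hhbar.ne' h hΩ⟩
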